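/- **Setting.** Let $\mathcal A$ be a unitary on $n$ qubits, $|in\rangle$ a unit initial state, and let $p$ be the probability that a designated output qubit of $\mathcal A|in\rangle$ is observed in the state $|1\rangle$. Let $0<t'<t\le 1$ and $0<\delta<1$. Put $$\beta=\sqrt{t'/t},\qquad \tau=\arcsin\sqrt t,\qquad s=\max\{0,\lfloor\log_3\tfrac{\pi}{4\tau}\rfloor\},\qquad \delta'=\frac{\delta}{1+s},\qquad h=\sin^2(3^s\tau),$$ and $\ell=\sin^2(3^s\beta\tau)$ if $t\le\frac12$, $\ell=t'$ if $t>\frac12$ (in which case $s=0$, $h=t$). Let $\epsilon'=\frac12(h-\ell)$ and $\epsilon^*=\frac12(h+\ell)$. **Subroutines.** For a unitary $B$ on the $n$ qubits let $Q_B=B\,(2|in\rangle\langle in|-I)\,B^\dagger S$, where $S$ flips the sign of the basis states whose output qubit is $1$. Amplitude amplification of $\mathcal A$ $k$ times gives $B=Q_{\mathcal A}^{k}\mathcal A$. Amplitude estimation of $B$ with an $m$-qubit control register, $M=2^m$, starts from $|in\rangle|0\rangle$, applies the quantum Fourier transform over $\mathbb Z_M$ to the control register and $B$ to the work register, applies $Q_B^{\,j}$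 controlled on the control value $j$ (as $M-1$ successive controlled $Q_B$), applies the inverse Fourier transform, measures $y\in\{0,\dots,M-1\}$ and outputs $\sin^2(\pi y/M)$. Additive amplitude estimation with error $\epsilon$ and error probability $\eta$ takes the least $m$ with $2^m\ge \frac{3\pi}{2\epsilon}$, performs $\lceil 7\ln\frac1\eta\rceil$ independent runs, and returns the (upper) median of the outputs. **Algorithm (Amplitude Separation).** For $i=0,1,\dots,s$: amplify $\mathcal A$ $k_i=(3^i-1)/2$ times; run additive amplitude estimation with parameters $\epsilon',\delta'$ on the amplified algorithm to get $\tilde p$; if $\tilde p\ge\epsilon^*$, stop and return "accept". If no iteration accepts, return "reject". The algorithm uses $\mathcal A$ only through black-box calls to (controlled) $\mathcal A$ and $\mathcal A^\dagger$. **Theorem.** 1. (Correctness.) For all such $\mathcal A$, $|in\rangle$, $t,t'$ and $0<\delta<1$: if $p\ge t$ the algorithm returns "accept" with probability at least $1-\delta$; if $p\le t'$ it returns "reject" with probability at least $1-\delta$. 2. (Query complexity.) There is an absolute constant $C>0$ such that for all $n$, $|in\rangle$, $0<t'<t\le1$ and $0<\delta\le\frac12$ the number of calls to $\mathcal A$ and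 $\mathcal A^\dagger$, for every $\mathcal A$ and every sequence of measurement outcomes, is at most $$C\,\frac{1}{(1-\beta)\sqrt t}\,\ln\frac{1+s}{\delta}.$$ In particular, for a suitable absolute $C$, it is at most $C\,g\,(1+\ln(1+g))$ with $g=\frac{1}{(1-\beta)\sqrt t}\ln\frac1\delta=\frac{1}{\sqrt t-\sqrt{t'}}\ln\frac1\delta$, that is, it is $\tilde O\big(\frac{1}{(1-\beta)\sqrt t}\log\frac1\delta\big)=\tilde O\big(\frac{1}{\sqrt t-\sqrt{t'}}\log\frac1\delta\big)$. -/

import Mathlib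

namespace AmplitudeSeparation

/-! ### Quantum algorithms and their acceptance probability -/

/-- Computational basis labels of an `n`-qubit register. -/
abbrev Bits (n : ℕ) : Type := Fin n → Bool

/-- A pure state of `n` qubits: a unit vector of amplitudes. -/
structure PureState (n : ℕ) where
  amp : Bits n → ℂ
  norm_one : ∑ x, ‖amp x‖ ^ 2 = 1

/-- The probability that the output qubit `out` of `A |ini⟩` is observed in the state `|1⟩`. -/
noncomputable def acceptanceProb {n : ℕ} (A : Matrix.unitaryGroup (Bits n) ℂ)
    (ini : PureState n) (out : Fin n) : ℝ :=
  ∑ x : Bits n, if x out = true then ‖((A : Matrix (Bits n) (Bits n) ℂ).mulVec ini.amp) x‖ ^ 2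
    else 0

/-! ### Black-box access: words, circuits and programs

None of the syntactic objects below contains the black box `A`; it enters only
when they are evaluated. -/

/-- An elementary operation on the `n`-qubit work register: a fixed unitary, or one call to the
black box `A` or to its inverse `A†`. -/
inductive Op (n : ℕ) : Type
  | fixed (U : Matrix.unitaryGroup (Bits n) ℂ)
  | call
  | callInv

namespace Op

/-- The unitary matrix of an operation when the black box is `A`. -/
noncomputable def eval {n : ℕ} (A : Matrix.unitaryGroup (Bits n) ℂ) :
    Op n → Matrix (Bits n) (Bits n) ℂ
  | fixed U => U
  | call => A
  | callInv => (A : Matrix (Bits n) (Bits n) ℂ).conjTranspose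

/-- The number of calls to `A` or `A†` of an operation. -/
def calls {n : ℕ} : Op n → ℕ
  | fixed _ => 0
  | call => 1
  | callInv => 1

/-- The inverse operation. -/
noncomputable def inv {n : ℕ} : Op n → Op n
  | fixed U => fixed U⁻¹
  | call => callInv
  | callInv => call

end Op

/-- A sequence of operations on the work register, executed from left to right. -/
abbrev Word (n : ℕ) : Type := List (Op n)

/-- The word that undoes a word. -/
noncomputable def Word.inv {n : ℕ} (w : Word n) : Word n := (w.map Op.inv).reverse

/-- A gate on the pair (work register, `M`-dimensional control register): an operation on the work
register controlled by the set `{j | c j = true}` of control values, or a fixed unitary on the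
control register. -/
inductive Gate (n M : ℕ) : Type
  | control (c : Fin M → Bool) (o : Op n)
  | register (V : Matrix.unitaryGroup (Fin M) ℂ)

namespace Gate

/-- The matrix of a gate on the joint register when the black box is `A`. -/
noncomputable def eval {n M : ℕ} (A : Matrix.unitaryGroup (Bits n) ℂ) :
    Gate n M → Matrix (Bits n × Fin M) (Bits n × Fin M) ℂ
  | control c o => Matrix.blockDiagonal fun j => if c j = true then o.eval A else 1
  | register V => Matrix.kronecker (1 : Matrix (Bits n) (Bits n) ℂ) (V : Matrix (Fin M) (Fin M) ℂ)

/-- The number of (controlled) calls to `A` or `A†` of a gate. -/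
def calls {n M : ℕ} : Gate n M → ℕ
  | control _ o => o.calls
  | register _ => 0

end Gate

/-- A sequence of gates, executed from left to right. -/
abbrev Circuit (n M : ℕ) : Type := List (Gate n M)

namespace Circuit

/-- The action of a circuit on a vector. -/
noncomputable def apply {n M : ℕ} (A : Matrix.unitaryGroup (Bits n) ℂ) :
    Circuit n M → (Bits n × Fin M → ℂ) → (Bits n × Fin M → ℂ)
  | [], ψ => ψ
  | g :: C, ψ => Circuit.apply A C ((g.eval A).mulVec ψ)

/-- The number of calls to `A` or `A†` of a circuit. -/
def calls {n M : ℕ} (C : Circuit n M) : ℕ := (C.map Gate.calls).sum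

/-- The probability of observing `y` when the control register is measured after running the
circuit on `|ini⟩|0⟩`. -/
noncomputable def measureProb {n m : ℕ} (A : Matrix.unitaryGroup (Bits n) ℂ) (ini : PureState n)
    (C : Circuit n (2 ^ m)) (y : Fin (2 ^ m)) : ℝ :=
  ∑ x : Bits n, ‖Circuit.apply A C (fun z => if z.2 = 0 then ini.amp z.1 else 0) (x, y)‖ ^ 2

end Circuit

/-- A decision procedure with black-box access to an `n`-qubit algorithm: it either returns an
answer (`true` for accept, `false` for reject), or runs a circuit with an `m`-qubit control register
on freshly prepared registers `|ini⟩|0⟩`, measures the control register, and continues depending on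
the observed value. -/
inductive Program (n : ℕ) : Type
  | ret (b : Bool)
  | run (m : ℕ) (C : Circuit n (2 ^ m)) (next : Fin (2 ^ m) → Program n)

namespace Program

/-- The probability that a program returns `b`. -/
noncomputable def outputProb {n : ℕ} (A : Matrix.unitaryGroup (Bits n) ℂ) (ini : PureState n) :
    Program n → Bool → ℝ
  | ret b', b => if b' = b then 1 else 0
  | run _ C next, b => ∑ y, C.measureProb A ini y * outputProb A ini (next y) b

/-- The worst-case number, over all measurement outcomes, of calls to `A` or `A†`. -/
def calls {n : ℕ} : Program n → ℕ
  | ret _ => 0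
  | run _ C next => Circuit.calls C + Finset.univ.sup fun y => calls (next y)

end Program

/-! ### Amplitude amplification -/

/-- The reflection that flips the sign of the basis states whose output qubit is `1`. -/
noncomputable def flipGood {n : ℕ} (out : Fin n) : Matrix.unitaryGroup (Bits n) ℂ :=
  ⟨Matrix.diagonal fun x => if x out = true then -1 else 1, by
    rw [Matrix.mem_unitaryGroup_iff, Matrix.star_eq_conjTranspose, Matrix.diagonal_conjTranspose,
      Matrix.diagonal_mul_diagonal, ← Matrix.diagonal_one]
    congr 1
    funext x
    by_cases h : x out = true <;> simp [h]⟩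

theorem PureState.star_dotProduct {n : ℕ} (v : PureState n) : star v.amp ⬝ᵥ v.amp = 1 := by
  have h := congrArg (fun r : ℝ => (r : ℂ)) v.norm_one
  simp only [Complex.ofReal_sum, Complex.ofReal_pow, Complex.ofReal_one] at h
  rw [← h]
  simp only [dotProduct, Pi.star_apply, RCLike.star_def]
  exact Finset.sum_congr rfl fun x _ => Complex.conj_mul' _

/-- The reflection `2|ini⟩⟨ini| - 1` about the initial state. -/
noncomputable def reflectInit {n : ℕ} (ini : PureState n) : Matrix.unitaryGroup (Bits n) ℂ :=
  ⟨(2 : ℂ) • Matrix.vecMulVec ini.amp (star ini.amp) - 1, by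
    have hP : Matrix.vecMulVec ini.amp (star ini.amp) * Matrix.vecMulVec ini.amp (star ini.amp)
        = Matrix.vecMulVec ini.amp (star ini.amp) := by
      rw [Matrix.vecMulVec_mul_vecMulVec, ini.star_dotProduct, one_smul]
    have hS : star ((2 : ℂ) • Matrix.vecMulVec ini.amp (star ini.amp) - 1)
        = (2 : ℂ) • Matrix.vecMulVec ini.amp (star ini.amp) - 1 := by
      ext i j
      by_cases h : i = j
      · subst h
        simp [Matrix.vecMulVec_apply, Matrix.star_apply, mul_comm]
      · simp [Matrix.vecMulVec_apply, Matrix.star_apply, mul_comm, h, Ne.symm h]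
    rw [Matrix.mem_unitaryGroup_iff, hS, sub_mul, mul_sub, smul_mul_smul_comm, hP]
    simp only [mul_one, one_mul]
    module⟩

/-- The amplification iterate `W (2|ini⟩⟨ini| - 1) W† S` of a word with unitary `W`, where `S`
is the reflection `flipGood`. -/
noncomputable def groverWord {n : ℕ} (ini : PureState n) (out : Fin n) (w : Word n) : Word n :=
  [Op.fixed (flipGood out)] ++ w.inv ++ [Op.fixed (reflectInit ini)] ++ w

/-- The black box followed by `k` rounds of amplitude amplification. -/
noncomputable def amplified {n : ℕ} (ini : PureState n) (out : Fin n) (k : ℕ) : Word n :=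
  [Op.call] ++ (List.replicate k (groverWord ini out [Op.call])).flatten

/-! ### Amplitude estimation -/

theorem qft_mem_unitaryGroup (M : ℕ) [NeZero M] :
    (Matrix.of fun j k : Fin M =>
      Complex.exp (2 * Real.pi * Complex.I * ((j : ℕ) * (k : ℕ) : ℂ) / M) / (Real.sqrt M : ℂ))
      ∈ Matrix.unitaryGroup (Fin M) ℂ := by
  have hM : M ≠ 0 := NeZero.ne M
  have hMC : (M : ℂ) ≠ 0 := Nat.cast_ne_zero.mpr hM
  set ζ : ℂ := Complex.exp (2 * Real.pi * Complex.I / M) with hζ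
  have hprim : IsPrimitiveRoot ζ M := Complex.isPrimitiveRoot_exp M hM
  have hexp : ∀ j k : ℕ,
      Complex.exp (2 * Real.pi * Complex.I * ((j : ℂ) * (k : ℂ)) / M) = (ζ ^ j) ^ k := by
    intro j k
    rw [hζ, ← pow_mul, ← Complex.exp_nat_mul]
    congr 1
    push_cast
    ring
  have hnorm : ζ * star ζ = 1 := by
    rw [RCLike.star_def, Complex.mul_conj', hprim.norm'_eq_one hM]
    norm_num
  have hs : (Real.sqrt M : ℂ) * (Real.sqrt M : ℂ) = M := by
    rw [← Complex.ofReal_mul, Real.mul_self_sqrt (Nat.cast_nonneg M), Complex.ofReal_natCast]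
  rw [Matrix.mem_unitaryGroup_iff]
  ext i j
  have hsum : ∀ k : Fin M,
      (ζ ^ (i : ℕ)) ^ (k : ℕ) / (Real.sqrt M : ℂ) * star ((ζ ^ (j : ℕ)) ^ (k : ℕ) / (Real.sqrt M : ℂ))
        = (ζ ^ (i : ℕ) * star (ζ ^ (j : ℕ))) ^ (k : ℕ) / M := by
    intro k
    rw [star_div₀, RCLike.star_def, Complex.conj_ofReal, div_mul_div_comm, hs,
      RCLike.star_def.symm, star_pow, mul_pow]
  simp only [Matrix.mul_apply, Matrix.star_apply, Matrix.of_apply, hexp, hsum]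
  rw [← Finset.sum_div,
    Fin.sum_univ_eq_sum_range (fun k => (ζ ^ (i : ℕ) * star (ζ ^ (j : ℕ))) ^ k) M]
  by_cases h : i = j
  · subst h
    rw [star_pow, ← mul_pow, hnorm]
    simp [hMC]
  · rw [Matrix.one_apply_ne h]
    have hx : ζ ^ (i : ℕ) * star (ζ ^ (j : ℕ)) ≠ 1 := by
      intro hx
      apply h
      have h2 : ζ ^ (i : ℕ) = ζ ^ (j : ℕ) := by
        have h3 : star (ζ ^ (j : ℕ)) * ζ ^ (j : ℕ) = 1 := by
          rw [star_pow, ← mul_pow, mul_comm, hnorm, one_pow]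
        calc ζ ^ (i : ℕ) = ζ ^ (i : ℕ) * (star (ζ ^ (j : ℕ)) * ζ ^ (j : ℕ)) := by rw [h3, mul_one]
          _ = ζ ^ (j : ℕ) := by rw [← mul_assoc, hx, one_mul]
      exact Fin.ext (hprim.pow_inj i.2 j.2 h2)
    have hz : (ζ ^ (i : ℕ) * star (ζ ^ (j : ℕ))) ^ M = 1 := by
      rw [mul_pow, star_pow, ← pow_mul, ← pow_mul, mul_comm (i : ℕ), mul_comm (j : ℕ), pow_mul,
        pow_mul, ← star_pow, hprim.pow_eq_one]
      simp
    rw [geom_sum_eq hx, hz]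
    simp

/-- The quantum Fourier transform on an `M`-dimensional register. -/
noncomputable def qft (M : ℕ) [NeZero M] : Matrix.unitaryGroup (Fin M) ℂ :=
  ⟨Matrix.of fun j k : Fin M =>
      Complex.exp (2 * Real.pi * Complex.I * ((j : ℕ) * (k : ℕ) : ℂ) / M) / (Real.sqrt M : ℂ),
    qft_mem_unitaryGroup M⟩

/-- The circuit of (basic) amplitude estimation for the algorithm given by the word `w`: a Fourier
transform on the control register, `w` on the work register, `j` rounds of the amplification
iterate of `w` when the control register holds `j`, and an inverse Fourier transform. -/
noncomputable def ampEstCircuit {n : ℕ} (ini : PureState n) (out : Fin n) (w : Word n)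
    (M : ℕ) [NeZero M] : Circuit n M :=
  [Gate.register (qft M)] ++ w.map (Gate.control fun _ => true) ++
    (List.range (M - 1)).flatMap
      (fun l => (groverWord ini out w).map (Gate.control fun j => decide (l < (j : ℕ)))) ++
    [Gate.register (qft M)⁻¹]

/-- The estimate of a probability obtained from the observed value `y` of the control register. -/
noncomputable def estimate (m : ℕ) (y : Fin (2 ^ m)) : ℝ :=
  Real.sin (Real.pi * (y : ℕ) / 2 ^ m) ^ 2

/-- The (upper) median of a nonempty list of reals. -/
noncomputable def median (l : List ℝ) : ℝ :=
  (l.insertionSort (· ≤ ·)).getD (l.length / 2) 0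

/-- Run amplitude estimation for `w` with an `m`-qubit control register `r` more times, collect the
estimates in `acc`, and pass the median of all of them on to `k`. -/
noncomputable def estimateRounds {n : ℕ} (ini : PureState n) (out : Fin n) (w : Word n) (m : ℕ)
    (k : ℝ → Program n) : ℕ → List ℝ → Program n
  | 0, acc => k (median acc)
  | r + 1, acc => Program.run m (ampEstCircuit ini out w (2 ^ m)) fun y =>
      estimateRounds ini out w m k r (estimate m y :: acc)

/-- The least number `m` of qubits with `2 ^ m ≥ 3π / (2ε)`. -/
noncomputable def estimationQubits (ε : ℝ) : ℕ := Nat.clog 2 ⌈3 * Real.pi / (2 * ε)⌉₊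

/-- The number of repetitions of amplitude estimation for error probability `δ`. -/
noncomputable def estimationRounds (δ : ℝ) : ℕ := ⌈7 * Real.log (1 / δ)⌉₊

/-- Amplitude estimation with additive error `ε` and error probability `δ`, for the algorithm given
by the word `w`; the estimate is passed on to `k`. -/
noncomputable def additiveAmpEst {n : ℕ} (ini : PureState n) (out : Fin n) (w : Word n)
    (ε δ : ℝ) (k : ℝ → Program n) : Program n :=
  estimateRounds ini out w (estimationQubits ε) k (estimationRounds δ) []

/-! ### Amplitude separation -/

/-- The separation variable, with `t' = β² t`. -/
noncomputable def beta (t t' : ℝ) : ℝ := Real.sqrt (t' / t)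

/-- The angle with `t = sin² τ`. -/
noncomputable def tau (t : ℝ) : ℝ := Real.arcsin (Real.sqrt t)

/-- The index of the last iteration, `⌊log₃ (π / (4τ))⌋`, and `0` where this is negative (that is,
for `t > 1/2`). -/
noncomputable def lastIter (t : ℝ) : ℕ := ⌊Real.logb 3 (Real.pi / (4 * tau t))⌋₊

/-- The upper amplified level `sin² (3^s τ)`. -/
noncomputable def highLevel (t : ℝ) : ℝ := Real.sin (3 ^ lastIter t * tau t) ^ 2

/-- The lower amplified level `sin² (3^s β τ)`; for `t > 1/2`, where nothing is amplified, it is the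
threshold `t'` itself. -/
noncomputable def lowLevel (t t' : ℝ) : ℝ :=
  if t ≤ 1 / 2 then Real.sin (3 ^ lastIter t * (beta t t' * tau t)) ^ 2 else t'

/-- The additive error of the estimations. -/
noncomputable def additiveError (t t' : ℝ) : ℝ := (highLevel t - lowLevel t t') / 2

/-- The decision threshold for the estimates. -/
noncomputable def decisionThreshold (t t' : ℝ) : ℝ := (highLevel t + lowLevel t t') / 2

open Classical in
/-- The iterations `i, i + 1, …` (the last argument is the number of iterations left) of amplitude
separation: amplify `(3^i - 1) / 2` times, estimate, accept if the estimate reaches the threshold;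
reject when no iteration is left. -/
noncomputable def separationLoop {n : ℕ} (ini : PureState n) (out : Fin n) (ε δ θ : ℝ) :
    ℕ → ℕ → Program n
  | _, 0 => Program.ret false
  | i, r + 1 => additiveAmpEst ini out (amplified ini out ((3 ^ i - 1) / 2)) ε δ fun p =>
      if θ ≤ p then Program.ret true else separationLoop ini out ε δ θ (i + 1) r

/-- The amplitude separation algorithm with thresholds `t' < t` and error `δ`. -/
noncomputable def amplitudeSeparation {n : ℕ} (ini : PureState n) (out : Fin n) (t t' δ : ℝ) :
    Program n :=
  separationLoop ini out (additiveError t t') (δ / (1 + lastIter t)) (decisionThreshold t t')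
    0 (lastIter t + 1)

/-- `x` times a logarithmic factor in `x`, the bound denoted by a soft O of `x`. -/
noncomputable def softBound (x : ℝ) : ℝ := x * (1 + Real.log (1 + x))

end AmplitudeSeparation

namespace AmplitudeSeparation

open Matrix

/-! ### Words and circuits as operators -/

/-! Everything reduces to plane rotations. Write the acceptance probability of a word as `sin² θ`.
The amplification iterate multiplies the good components of the state by one real number and the bad
ones by another, and these factors encode the angle `(2j+1)θ` (`exists_groverWord_pow`). Hence `(3^i
- 1)/2` rounds turn the angle `θ` into `3^i θ`. For amplitude estimation, splitting sine and cosine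
into exponentials shows that the outcome distribution is the average of two Fejér kernels, centred
at `θ` and `-θ` (`measureProb_eq_fejer`). The two grid points next to each centre carry at least 3/4
of the kernel's mass, so one run errs by `ε` or more with probability at most 1/4. The median of
repeated runs lowers this to any `η` by an exponential moment bound. Let `a = 3^s τ`, with `τ` the
angle of `t`. If `p ≥ t`, take the first iteration whose angle reaches `a`. An angle below `a` at
most triples, and `a ≤ π/4` when anything is amplified, so the angle lands in `[a, π - a]`, where
the sine is at least `sin a` (`exists_highLevel_le`). That single iteration has to succeed. If `p ≤
t'`, concavity of the sine bounds the initial angle by `βτ`, so all amplified angles stay on the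
increasing branch and below `3^s βτ` (`sin_sq_le_lowLevel`). All `s + 1` iterations must then
succeed, which is why the error is divided by `1 + s`. For the cost, `a > π/12` makes the gap of the
two levels at least a constant times `1 - β`, so `2^m` is `O(1/(1-β))`. Iteration `i` uses words of
`3^i` calls, and the geometric sum is `O(3^s)`, that is `O(1/√t)`. -/

/-- The unitary of an operation when the black box is `A`. -/
noncomputable def Op.unitary {n : ℕ} (A : Matrix.unitaryGroup (Bits n) ℂ) :
    Op n → Matrix.unitaryGroup (Bits n) ℂ
  | fixed U => U
  | call => A
  | callInv => A⁻¹

theorem Op.coe_unitary {n : ℕ} (A : Matrix.unitaryGroup (Bits n) ℂ) (o : Op n) :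
    (o.unitary A : Matrix (Bits n) (Bits n) ℂ) = o.eval A := by
  cases o <;> rfl

theorem Op.unitary_inv {n : ℕ} (A : Matrix.unitaryGroup (Bits n) ℂ) (o : Op n) :
    o.inv.unitary A = (o.unitary A)⁻¹ := by
  cases o <;> simp [Op.unitary, Op.inv]

/-- The unitary of a word when the black box is `A`. -/
noncomputable def Word.unitary {n : ℕ} (A : Matrix.unitaryGroup (Bits n) ℂ) (w : Word n) :
    Matrix.unitaryGroup (Bits n) ℂ :=
  -- Words run from left to right, while in a product of matrices the rightmost factor acts first.
  (w.map (Op.unitary A)).reverse.prod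

theorem Word.unitary_nil {n : ℕ} (A : Matrix.unitaryGroup (Bits n) ℂ) :
    Word.unitary A [] = 1 := by
  simp [Word.unitary]

theorem Word.unitary_append {n : ℕ} (A : Matrix.unitaryGroup (Bits n) ℂ) (v w : Word n) :
    Word.unitary A (v ++ w) = Word.unitary A w * Word.unitary A v := by
  simp [Word.unitary]

theorem Word.unitary_cons {n : ℕ} (A : Matrix.unitaryGroup (Bits n) ℂ) (o : Op n) (w : Word n) :
    Word.unitary A (o :: w) = Word.unitary A w * o.unitary A := by
  simp [Word.unitary]

theorem Word.unitary_inv {n : ℕ} (A : Matrix.unitaryGroup (Bits n) ℂ) (w : Word n) :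
    Word.unitary A w.inv = (Word.unitary A w)⁻¹ := by
  induction w with
  | nil => simp [Word.unitary, Word.inv]
  | cons o w ih =>
    have : Word.inv (o :: w) = Word.inv w ++ [o.inv] := by simp [Word.inv]
    rw [this, Word.unitary_append, ih, Word.unitary_cons, Word.unitary_cons, Word.unitary_nil,
      Op.unitary_inv, one_mul, _root_.mul_inv_rev]

/-- The unitary of the amplification iterate. -/
theorem unitary_groverWord {n : ℕ} (A : Matrix.unitaryGroup (Bits n) ℂ) (ini : PureState n)
    (out : Fin n) (w : Word n) :
    Word.unitary A (groverWord ini out w) =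
      Word.unitary A w * reflectInit ini * (Word.unitary A w)⁻¹ * flipGood out := by
  simp [groverWord, Word.unitary_append, Word.unitary_cons, Word.unitary_inv, Op.unitary,
    mul_assoc]

theorem unitary_amplified {n : ℕ} (A : Matrix.unitaryGroup (Bits n) ℂ) (ini : PureState n)
    (out : Fin n) (k : ℕ) :
    Word.unitary A (amplified ini out k) =
      Word.unitary A (groverWord ini out [Op.call]) ^ k * A := by
  have h : ∀ w : Word n, Word.unitary A (List.replicate k w).flatten = Word.unitary A w ^ k := by
    intro w
    induction k with
    | zero => simp [Word.unitary]
    | succ k ih => rw [List.replicate_succ, List.flatten_cons, Word.unitary_append, ih, pow_succ]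
  rw [amplified, Word.unitary_append, h, Word.unitary_cons, Word.unitary_nil, Op.unitary, one_mul]

theorem Circuit.apply_append {n M : ℕ} (A : Matrix.unitaryGroup (Bits n) ℂ) (C D : Circuit n M)
    (ψ : Bits n × Fin M → ℂ) :
    Circuit.apply A (C ++ D) ψ = Circuit.apply A D (Circuit.apply A C ψ) := by
  induction C generalizing ψ with
  | nil => rfl
  | cons g C ih => exact ih _

theorem Gate.eval_control_mulVec {n M : ℕ} (A : Matrix.unitaryGroup (Bits n) ℂ)
    (c : Fin M → Bool) (o : Op n) (ψ : Bits n × Fin M → ℂ) (x : Bits n) (j : Fin M) :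
    ((Gate.control c o).eval A *ᵥ ψ) (x, j) =
      if c j = true then ((o.unitary A : Matrix (Bits n) (Bits n) ℂ) *ᵥ fun x => ψ (x, j)) x
      else ψ (x, j) := by
  have h : ((Gate.control c o).eval A *ᵥ ψ) (x, j) =
      ((if c j = true then o.eval A else 1) *ᵥ fun x => ψ (x, j)) x := by
    simp [Gate.eval, Matrix.mulVec, dotProduct, Fintype.sum_prod_type, Matrix.blockDiagonal_apply,
      ite_mul]
  rw [h, Op.coe_unitary]
  split_ifs <;> simp

theorem Gate.eval_register_mulVec {n M : ℕ} (A : Matrix.unitaryGroup (Bits n) ℂ)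
    (V : Matrix.unitaryGroup (Fin M) ℂ) (ψ : Bits n × Fin M → ℂ) (x : Bits n) (j : Fin M) :
    ((Gate.register V).eval A *ᵥ ψ) (x, j) =
      ∑ k, (V : Matrix (Fin M) (Fin M) ℂ) j k * ψ (x, k) := by
  simp [Gate.eval, Matrix.mulVec, dotProduct, Fintype.sum_prod_type, Matrix.kronecker,
    Matrix.kroneckerMap_apply, Matrix.one_apply, ite_mul, Finset.sum_ite_irrel]

theorem Circuit.apply_map_control {n M : ℕ} (A : Matrix.unitaryGroup (Bits n) ℂ)
    (c : Fin M → Bool) (w : Word n) (ψ : Bits n × Fin M → ℂ) (x : Bits n) (j : Fin M) :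
    Circuit.apply A (w.map (Gate.control c)) ψ (x, j) =
      if c j = true then
        ((Word.unitary A w : Matrix (Bits n) (Bits n) ℂ) *ᵥ fun x => ψ (x, j)) x
      else ψ (x, j) := by
  induction w generalizing ψ with
  | nil => simp [Circuit.apply, Word.unitary]
  | cons o w ih =>
    rw [List.map_cons, Circuit.apply, ih, Word.unitary_cons]
    simp only [Gate.eval_control_mulVec]
    split_ifs with h
    · simp only [Submonoid.coe_mul]
      rw [← Matrix.mulVec_mulVec]
    · rfl

/-- A word applied once for each `l < L` below the control value acts as a power of the word. -/
theorem Circuit.apply_controlled_powers {n M : ℕ} (A : Matrix.unitaryGroup (Bits n) ℂ)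
    (w : Word n) (L : ℕ) (ψ : Bits n × Fin M → ℂ) (x : Bits n) (j : Fin M) :
    Circuit.apply A ((List.range L).flatMap
        fun l => w.map (Gate.control fun j : Fin M => decide (l < (j : ℕ)))) ψ (x, j) =
      ((Word.unitary A w : Matrix (Bits n) (Bits n) ℂ) ^ min (j : ℕ) L *ᵥ fun x => ψ (x, j)) x := by
  induction L generalizing x with
  | zero => simp [Circuit.apply]
  | succ L ih =>
    rw [List.range_succ, List.flatMap_append, Circuit.apply_append, List.flatMap_singleton,
      Circuit.apply_map_control]
    simp only [ih, decide_eq_true_eq]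
    split_ifs with h
    · rw [min_eq_right h.le, min_eq_right (Nat.succ_le_of_lt h), pow_succ', ← Matrix.mulVec_mulVec]
    · rw [min_eq_left (by omega), min_eq_left (by omega)]

theorem sum_norm_sq_mulVec {ι : Type*} [Fintype ι] [DecidableEq ι] {U : Matrix ι ι ℂ}
    (hU : U ∈ Matrix.unitaryGroup ι ℂ) (v : ι → ℂ) :
    ∑ z, ‖(U *ᵥ v) z‖ ^ 2 = ∑ z, ‖v z‖ ^ 2 := by
  have key : ∀ v : ι → ℂ, ((∑ z, ‖v z‖ ^ 2 : ℝ) : ℂ) = star v ⬝ᵥ v := by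
    intro v
    push_cast
    exact Finset.sum_congr rfl fun z _ => (Complex.conj_mul' _).symm
  rw [← Complex.ofReal_inj, key, key, Matrix.star_mulVec, ← Matrix.dotProduct_mulVec,
    Matrix.mulVec_mulVec]
  have : Uᴴ * U = 1 := Matrix.mem_unitaryGroup_iff'.mp hU
  rw [this, Matrix.one_mulVec]

theorem Gate.eval_mem_unitaryGroup {n M : ℕ} (A : Matrix.unitaryGroup (Bits n) ℂ) (g : Gate n M) :
    g.eval A ∈ Matrix.unitaryGroup (Bits n × Fin M) ℂ := by
  cases g with
  | control c o =>
    rw [Gate.eval, Matrix.mem_unitaryGroup_iff, Matrix.star_eq_conjTranspose,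
      Matrix.blockDiagonal_conjTranspose, ← Matrix.blockDiagonal_mul, ← Matrix.blockDiagonal_one]
    congr 1
    funext j
    rw [← Op.coe_unitary]
    split_ifs
    · exact Matrix.mem_unitaryGroup_iff.mp (o.unitary A).2
    · simp
  | register V => exact Matrix.kronecker_mem_unitary (one_mem _) V.2

theorem Circuit.sum_measureProb {n m : ℕ} (A : Matrix.unitaryGroup (Bits n) ℂ) (ini : PureState n)
    (C : Circuit n (2 ^ m)) : ∑ y, C.measureProb A ini y = 1 := by
  have h : ∀ (C : Circuit n (2 ^ m)) (ψ : Bits n × Fin (2 ^ m) → ℂ),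
      ∑ z, ‖Circuit.apply A C ψ z‖ ^ 2 = ∑ z, ‖ψ z‖ ^ 2 := by
    intro C
    induction C with
    | nil => exact fun _ => rfl
    | cons g C ih =>
      exact fun ψ => (ih _).trans (sum_norm_sq_mulVec (g.eval_mem_unitaryGroup A) ψ)
  simp only [Circuit.measureProb]
  rw [Finset.sum_comm, ← Fintype.sum_prod_type', h, Fintype.sum_prod_type, ← ini.norm_one]
  refine Finset.sum_congr rfl fun x _ => ?_
  rw [Finset.sum_eq_single 0] <;> simp +contextual

theorem Circuit.measureProb_nonneg {n m : ℕ} (A : Matrix.unitaryGroup (Bits n) ℂ)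
    (ini : PureState n) (C : Circuit n (2 ^ m)) (y : Fin (2 ^ m)) : 0 ≤ C.measureProb A ini y :=
  Finset.sum_nonneg fun _ _ => by positivity

theorem Program.outputProb_nonneg {n : ℕ} (A : Matrix.unitaryGroup (Bits n) ℂ)
    (ini : PureState n) (P : Program n) (b : Bool) : 0 ≤ P.outputProb A ini b := by
  induction P with
  | ret b' => rw [Program.outputProb]; positivity
  | run m C next ih =>
    exact Finset.sum_nonneg fun y _ => mul_nonneg (C.measureProb_nonneg A ini y) (ih y)

/-- The distribution of the observed value in amplitude estimation. -/
theorem measureProb_ampEstCircuit {n m : ℕ} (A : Matrix.unitaryGroup (Bits n) ℂ)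
    (ini : PureState n) (out : Fin n) (w : Word n) (y : Fin (2 ^ m)) :
    (ampEstCircuit ini out w (2 ^ m)).measureProb A ini y =
      ∑ x, ‖∑ j : Fin (2 ^ m),
        Complex.exp (-(2 * Real.pi * Complex.I * ((j : ℕ) * (y : ℕ)) / (2 ^ m : ℕ))) / (2 ^ m : ℕ) *
        ((Word.unitary A (groverWord ini out w) : Matrix (Bits n) (Bits n) ℂ) ^ (j : ℕ) *ᵥ
          ((Word.unitary A w : Matrix (Bits n) (Bits n) ℂ) *ᵥ ini.amp)) x‖ ^ 2 := by
  have hM : 0 < 2 ^ m := by positivity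
  rw [Circuit.measureProb]
  refine Finset.sum_congr rfl fun x _ => ?_
  congr 2
  rw [ampEstCircuit, Circuit.apply_append, Circuit.apply_append, Circuit.apply_append]
  simp only [Circuit.apply]
  rw [Gate.eval_register_mulVec]
  refine Finset.sum_congr rfl fun j _ => ?_
  -- The `M - 1` controlled iterates suffice, since a control value `j < M` needs only `j` of them.
  rw [Circuit.apply_controlled_powers, min_eq_left (by omega)]
  simp only [Circuit.apply_map_control, if_true, Gate.eval_register_mulVec]
  -- The Fourier transform of `|0⟩` is uniform with amplitude `1/√M`; the inverse transform
  -- contributes the other `1/√M`.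
  have h0 : (fun x : Bits n => ∑ k : Fin (2 ^ m), (qft (2 ^ m) : Matrix _ _ ℂ) j k *
      (if k = 0 then ini.amp x else 0)) = ((Real.sqrt (2 ^ m : ℕ) : ℂ)⁻¹) • ini.amp := by
    funext x
    simp [qft]
  rw [h0, Matrix.mulVec_smul]
  rw [show (fun x => ((Real.sqrt (2 ^ m : ℕ) : ℂ)⁻¹ •
    ((Word.unitary A w : Matrix (Bits n) (Bits n) ℂ) *ᵥ ini.amp)) x) = _ from rfl,
    Matrix.mulVec_smul, Pi.smul_apply, smul_eq_mul, ← mul_assoc]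
  congr 1
  have hs : (Real.sqrt (2 ^ m : ℕ) : ℂ) * (Real.sqrt (2 ^ m : ℕ) : ℂ) = (2 ^ m : ℕ) := by
    rw [← Complex.ofReal_mul, Real.mul_self_sqrt (Nat.cast_nonneg _), Complex.ofReal_natCast]
  have hq : (((qft (2 ^ m))⁻¹ : Matrix.unitaryGroup (Fin (2 ^ m)) ℂ) : Matrix _ _ ℂ) y j =
      star ((qft (2 ^ m) : Matrix _ _ ℂ) j y) := rfl
  rw [hq]
  simp only [qft, Matrix.of_apply]
  rw [star_div₀, RCLike.star_def, Complex.conj_ofReal, ← div_eq_mul_inv, div_div, hs,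
    ← Complex.exp_conj]
  congr 2
  have h2 : (starRingEnd ℂ) 2 = 2 := Complex.conj_ofNat 2
  simp [neg_div, h2]

/-! ### Amplitude amplification as a rotation -/

theorem sum_norm_sq_word {n : ℕ} (A : Matrix.unitaryGroup (Bits n) ℂ) (ini : PureState n) :
    ∑ x, ‖((A : Matrix (Bits n) (Bits n) ℂ) *ᵥ ini.amp) x‖ ^ 2 = 1 :=
  (sum_norm_sq_mulVec A.2 _).trans ini.norm_one

theorem sum_ite_mul_norm_sq {n : ℕ} (A : Matrix.unitaryGroup (Bits n) ℂ) (ini : PureState n)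
    (out : Fin n) (a b : ℝ) :
    ∑ x, (if x out = true then a else b) * ‖((A : Matrix (Bits n) (Bits n) ℂ) *ᵥ ini.amp) x‖ ^ 2 =
      a * acceptanceProb A ini out + b * (1 - acceptanceProb A ini out) := by
  rw [acceptanceProb, ← sum_norm_sq_word A ini, ← Finset.sum_sub_distrib, Finset.mul_sum,
    Finset.mul_sum, ← Finset.sum_add_distrib]
  refine Finset.sum_congr rfl fun x _ => ?_
  split_ifs <;> ring

theorem acceptanceProb_nonneg {n : ℕ} (A : Matrix.unitaryGroup (Bits n) ℂ) (ini : PureState n)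
    (out : Fin n) : 0 ≤ acceptanceProb A ini out :=
  Finset.sum_nonneg fun _ _ => by positivity

theorem acceptanceProb_le_one {n : ℕ} (A : Matrix.unitaryGroup (Bits n) ℂ) (ini : PureState n)
    (out : Fin n) : acceptanceProb A ini out ≤ 1 := by
  rw [acceptanceProb, ← sum_norm_sq_word A ini]
  refine Finset.sum_le_sum fun x _ => ?_
  split_ifs
  · exact le_rfl
  · positivity

/-- Conjugation by `B` carries the reflection about `|ini⟩` to the reflection `2|ψ⟩⟨ψ| - 1` about `ψ
= B|ini⟩`, so the iterate depends on `B` only through `ψ`. -/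
theorem reflectInit_conj_mulVec {n : ℕ} (B : Matrix.unitaryGroup (Bits n) ℂ) (ini : PureState n)
    (φ : Bits n → ℂ) (x : Bits n) :
    (((B * reflectInit ini * B⁻¹ : Matrix.unitaryGroup (Bits n) ℂ) :
        Matrix (Bits n) (Bits n) ℂ) *ᵥ φ) x =
      2 * (star ((B : Matrix (Bits n) (Bits n) ℂ) *ᵥ ini.amp) ⬝ᵥ φ) *
        ((B : Matrix (Bits n) (Bits n) ℂ) *ᵥ ini.amp) x - φ x := by
  have hinv : ((B⁻¹ : Matrix.unitaryGroup (Bits n) ℂ) : Matrix (Bits n) (Bits n) ℂ) =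
    (B : Matrix (Bits n) (Bits n) ℂ)ᴴ := rfl
  have hB : (B : Matrix (Bits n) (Bits n) ℂ) * (B : Matrix (Bits n) (Bits n) ℂ)ᴴ = 1 :=
    Matrix.mem_unitaryGroup_iff.mp B.2
  have h : ((B * reflectInit ini * B⁻¹ : Matrix.unitaryGroup (Bits n) ℂ) :
        Matrix (Bits n) (Bits n) ℂ) =
      (2 : ℂ) • Matrix.vecMulVec ((B : Matrix (Bits n) (Bits n) ℂ) *ᵥ ini.amp)
        (star ((B : Matrix (Bits n) (Bits n) ℂ) *ᵥ ini.amp)) - 1 := by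
    simp only [Submonoid.coe_mul, hinv, reflectInit]
    rw [mul_sub, sub_mul, mul_one, hB, Matrix.mul_smul, Matrix.smul_mul, Matrix.mul_vecMulVec,
      Matrix.vecMulVec_mul, Matrix.star_mulVec]
  rw [h, Matrix.sub_mulVec, Matrix.one_mulVec, Matrix.smul_mulVec, Matrix.vecMulVec_mulVec]
  simp only [Pi.sub_apply, Pi.smul_apply, smul_eq_mul, MulOpposite.smul_eq_mul_unop,
    MulOpposite.unop_op]
  ring

/-- The amplification iterate rotates by `2θ` in the plane spanned by the good and the bad part of
the state. -/
theorem exists_groverWord_pow {n : ℕ} (A : Matrix.unitaryGroup (Bits n) ℂ) (ini : PureState n)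
    (out : Fin n) (w : Word n) (θ : ℝ)
    (hθ : acceptanceProb (Word.unitary A w) ini out = Real.sin θ ^ 2) (j : ℕ) :
    ∃ u v : ℝ, u * Real.sin θ = Real.sin ((2 * j + 1) * θ) ∧
      v * Real.cos θ = Real.cos ((2 * j + 1) * θ) ∧
      ∀ x, ((Word.unitary A (groverWord ini out w) : Matrix (Bits n) (Bits n) ℂ) ^ j *ᵥ
          ((Word.unitary A w : Matrix (Bits n) (Bits n) ℂ) *ᵥ ini.amp)) x =
        ((if x out = true then u else v : ℝ) : ℂ) *
          ((Word.unitary A w : Matrix (Bits n) (Bits n) ℂ) *ᵥ ini.amp) x := by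
  -- The factors `u`, `v` are pinned down by products with `sin θ` and `cos θ` rather than by
  -- quotients, so `p = 0` and `p = 1` need no separate treatment.
  induction j with
  | zero => exact ⟨1, 1, by simp, by simp, by simp⟩
  | succ j ih =>
    obtain ⟨u, v, hu, hv, h⟩ := ih
    set B := Word.unitary A w with hB
    set ψ := (B : Matrix (Bits n) (Bits n) ℂ) *ᵥ ini.amp with hψ
    -- `d` is the overlap of `ψ` with the current vector after the sign flip. Reflecting about `ψ`
    -- then yields the factors `2d + u` and `2d - v`.
    set d : ℝ := (-u) * Real.sin θ ^ 2 + v * (1 - Real.sin θ ^ 2) with hd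
    have hflip : ∀ x, ((flipGood out : Matrix (Bits n) (Bits n) ℂ) *ᵥ
        ((Word.unitary A (groverWord ini out w) : Matrix (Bits n) (Bits n) ℂ) ^ j *ᵥ ψ)) x =
        ((if x out = true then -u else v : ℝ) : ℂ) * ψ x := by
      intro x
      simp only [flipGood, Matrix.mulVec_diagonal, h]
      split_ifs <;> simp
    have hdot : star ψ ⬝ᵥ ((flipGood out : Matrix (Bits n) (Bits n) ℂ) *ᵥ
        ((Word.unitary A (groverWord ini out w) : Matrix (Bits n) (Bits n) ℂ) ^ j *ᵥ ψ)) =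
        (d : ℂ) := by
      rw [hd, ← hθ, ← sum_ite_mul_norm_sq, Complex.ofReal_sum]
      refine Finset.sum_congr rfl fun x _ => ?_
      rw [hflip, Complex.ofReal_mul, Complex.ofReal_pow, ← hψ, ← Complex.conj_mul', Pi.star_apply,
        RCLike.star_def]
      ring
    have hcos : 1 - Real.sin θ ^ 2 = Real.cos θ ^ 2 := by rw [← Real.sin_sq_add_cos_sq θ]; ring
    have hang : (2 * ((j + 1 : ℕ) : ℝ) + 1) * θ = (2 * j + 1) * θ + 2 * θ := by push_cast; ring
    refine ⟨2 * d + u, 2 * d - v, ?_, ?_, ?_⟩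
    · rw [hang, Real.sin_add, Real.sin_two_mul, Real.cos_two_mul', ← hu, ← hv, hd, hcos]
      linear_combination (u * Real.sin θ) * hcos
    · rw [hang, Real.cos_add, Real.sin_two_mul, Real.cos_two_mul', ← hu, ← hv, hd, hcos]
      linear_combination (-v * Real.cos θ) * hcos
    · intro x
      rw [pow_succ', ← Matrix.mulVec_mulVec]
      generalize (Word.unitary A (groverWord ini out w) : Matrix (Bits n) (Bits n) ℂ) ^ j *ᵥ ψ = φ
        at hdot hflip ⊢
      rw [unitary_groverWord, Submonoid.coe_mul, ← Matrix.mulVec_mulVec, ← hB,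
        reflectInit_conj_mulVec, ← hψ, hdot, hflip]
      split_ifs <;> push_cast <;> ring

theorem acceptanceProb_amplified {n : ℕ} (A : Matrix.unitaryGroup (Bits n) ℂ) (ini : PureState n)
    (out : Fin n) (θ : ℝ) (hθ : acceptanceProb A ini out = Real.sin θ ^ 2) (k : ℕ) :
    acceptanceProb (Word.unitary A (amplified ini out k)) ini out =
      Real.sin ((2 * k + 1) * θ) ^ 2 := by
  have hA : Word.unitary A [Op.call] = A := by simp [Word.unitary, Op.unitary]
  obtain ⟨u, v, hu, -, h⟩ := exists_groverWord_pow A ini out [Op.call] θ (by rw [hA, hθ]) k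
  rw [hA] at h
  rw [← hu, mul_pow, ← hθ, unitary_amplified, acceptanceProb, acceptanceProb, Finset.mul_sum]
  refine Finset.sum_congr rfl fun x _ => ?_
  split_ifs with hx
  · rw [Submonoid.coe_mul, ← Matrix.mulVec_mulVec, SubmonoidClass.coe_pow, h, if_pos hx, norm_mul,
      mul_pow, Complex.norm_real, Real.norm_eq_abs, sq_abs]
  · simp

/-! ### The distribution of the observed value -/

/-- The normalized Fejér kernel `|∑_{j < M} exp (ijφ)|² / M²`. -/
noncomputable def fejer (M : ℕ) (φ : ℝ) : ℝ :=
  ‖∑ j : Fin M, Complex.exp ((j : ℕ) * φ * Complex.I)‖ ^ 2 / (M : ℝ) ^ 2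

theorem fejer_nonneg (M : ℕ) (φ : ℝ) : 0 ≤ fejer M φ := by
  unfold fejer; positivity

/-- Good and bad parts are orthogonal, so the probability is `|a sin θ|² + |b cos θ|²`. With `E`,
`F` the Fourier sums of `exp (±i(2j+1)θ)`, the two amplitudes are `(E - F)/(2i)` and `(E + F)/2`.
The parallelogram law removes the cross terms and leaves `(|E|² + |F|²)/2`. -/
theorem measureProb_eq_fejer {n m : ℕ} (A : Matrix.unitaryGroup (Bits n) ℂ)
    (ini : PureState n) (out : Fin n) (w : Word n) (θ : ℝ)
    (hθ : acceptanceProb (Word.unitary A w) ini out = Real.sin θ ^ 2) (y : Fin (2 ^ m)) :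
    (ampEstCircuit ini out w (2 ^ m)).measureProb A ini y =
      (fejer (2 ^ m) (2 * θ - 2 * Real.pi * (y : ℕ) / (2 ^ m : ℕ)) +
        fejer (2 ^ m) (2 * (-θ) - 2 * Real.pi * (y : ℕ) / (2 ^ m : ℕ))) / 2 := by
  choose u v hu hv h using exists_groverWord_pow A ini out w θ hθ
  rw [measureProb_ampEstCircuit]
  revert y
  generalize 2 ^ m = M
  intro y
  set c : Fin M → ℂ := fun j => Complex.exp (-(2 * Real.pi * Complex.I * ((j : ℕ) * (y : ℕ)) /
    (M : ℕ))) / (M : ℕ) with hc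
  set a := ∑ j : Fin M, c j * (u j : ℂ) with ha
  set b := ∑ j : Fin M, c j * (v j : ℂ) with hb
  have h1 : ∀ x, ‖∑ j : Fin M, c j *
        ((Word.unitary A (groverWord ini out w) : Matrix (Bits n) (Bits n) ℂ) ^ (j : ℕ) *ᵥ
          ((Word.unitary A w : Matrix (Bits n) (Bits n) ℂ) *ᵥ ini.amp)) x‖ ^ 2 =
      (if x out = true then ‖a‖ ^ 2 else ‖b‖ ^ 2) *
        ‖((Word.unitary A w : Matrix (Bits n) (Bits n) ℂ) *ᵥ ini.amp) x‖ ^ 2 := by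
    intro x
    simp only [h, ← mul_assoc]
    rw [← Finset.sum_mul, norm_mul, mul_pow]
    split_ifs <;> rfl
  rw [Finset.sum_congr rfl fun x _ => h1 x, sum_ite_mul_norm_sq, hθ, ← Real.cos_sq',
    ← sq_abs (Real.sin θ), ← sq_abs (Real.cos θ), ← Real.norm_eq_abs, ← Real.norm_eq_abs,
    ← Complex.norm_real, ← Complex.norm_real (Real.cos θ), ← mul_pow, ← mul_pow, ← norm_mul,
    ← norm_mul]
  have hE : ∀ θ : ℝ, fejer M (2 * θ - 2 * Real.pi * (y : ℕ) / M) =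
      ‖∑ j : Fin M, c j * Complex.exp (((2 * (j : ℕ) + 1) * θ : ℝ) * Complex.I)‖ ^ 2 := by
    intro θ
    have : ∀ j : Fin M, c j * Complex.exp (((2 * (j : ℕ) + 1) * θ : ℝ) * Complex.I) =
        Complex.exp (θ * Complex.I) / (M : ℕ) *
          Complex.exp ((j : ℕ) * (2 * θ - 2 * Real.pi * (y : ℕ) / M : ℝ) * Complex.I) := by
      intro j
      rw [hc, div_mul_eq_mul_div, div_mul_eq_mul_div, ← Complex.exp_add, ← Complex.exp_add]
      congr 2
      push_cast
      ring
    rw [Finset.sum_congr rfl fun j _ => this j, ← Finset.mul_sum, norm_mul, norm_div,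
      Complex.norm_exp_ofReal_mul_I, Complex.norm_natCast, fejer]
    ring
  rw [hE, hE]
  set E := ∑ j : Fin M, c j * Complex.exp (((2 * (j : ℕ) + 1) * θ : ℝ) * Complex.I) with hEd
  set F := ∑ j : Fin M, c j * Complex.exp (((2 * (j : ℕ) + 1) * (-θ) : ℝ) * Complex.I) with hFd
  have hs : a * (Real.sin θ : ℂ) = (E - F) / (2 * Complex.I) := by
    rw [ha, hEd, hFd, Finset.sum_mul, ← Finset.sum_sub_distrib, Finset.sum_div]
    refine Finset.sum_congr rfl fun j _ => ?_
    rw [mul_assoc, ← Complex.ofReal_mul, hu, Complex.ofReal_sin, Complex.sin]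
    field_simp
    rw [Complex.I_sq]
    push_cast
    ring_nf
  have hcs : b * (Real.cos θ : ℂ) = (E + F) / 2 := by
    rw [hb, hEd, hFd, Finset.sum_mul, ← Finset.sum_add_distrib, Finset.sum_div]
    refine Finset.sum_congr rfl fun j _ => ?_
    rw [mul_assoc, ← Complex.ofReal_mul, hv, Complex.ofReal_cos, Complex.cos]
    push_cast
    ring_nf
  rw [hs, hcs, norm_div, norm_div, norm_mul, Complex.norm_I]
  have := parallelogram_law_with_norm ℝ E F
  norm_num
  nlinarith

/-! ### Lower bounds for the Fejér kernel -/

theorem fejer_add_two_pi_mul_int (M : ℕ) (φ : ℝ) (q : ℤ) :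
    fejer M (φ + 2 * Real.pi * q) = fejer M φ := by
  unfold fejer
  congr 3
  refine Finset.sum_congr rfl fun j _ => Complex.exp_eq_exp_iff_exists_int.mpr ⟨(j : ℕ) * q, ?_⟩
  push_cast
  ring

/-- The geometric sum has norm `2|sin πx| / |exp (iφ) - 1|`, and the chord `|exp (iφ) - 1|` is at
most the arc `|φ|`. -/
theorem sinc_sq_le_fejer (M : ℕ) (hM : 0 < M) (x : ℝ) :
    Real.sinc (Real.pi * x) ^ 2 ≤ fejer M (2 * Real.pi * x / M) := by
  have hM' : (0 : ℝ) < M := Nat.cast_pos.mpr hM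
  have hpi := Real.pi_pos
  rcases eq_or_ne x 0 with rfl | hx
  · simp [fejer, hM.ne']
  rw [Real.sinc_of_ne_zero (by positivity), fejer, ← div_pow, sq_le_sq, abs_div, abs_div, abs_norm,
    abs_of_pos hM', div_le_div_iff₀ (by positivity) hM']
  set φ : ℝ := 2 * Real.pi * x / M with hφ
  have hsum : ∑ j : Fin M, Complex.exp ((j : ℕ) * φ * Complex.I) =
      ∑ j ∈ Finset.range M, Complex.exp (Complex.I * φ) ^ j := by
    rw [Finset.sum_range]
    refine Finset.sum_congr rfl fun j _ => ?_
    rw [← Complex.exp_nat_mul]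
    ring_nf
  have hgeom := congrArg norm (geom_sum_mul (Complex.exp (Complex.I * φ)) M)
  have hpow : Complex.exp (Complex.I * φ) ^ M = Complex.exp (Complex.I * (2 * Real.pi * x : ℝ)) := by
    rw [← Complex.exp_nat_mul, hφ]
    congr 1
    have : (M : ℂ) ≠ 0 := Nat.cast_ne_zero.mpr hM.ne'
    push_cast
    field_simp
  rw [norm_mul, hpow, Complex.norm_exp_I_mul_ofReal_sub_one (2 * Real.pi * x), Real.norm_eq_abs,
    abs_mul, abs_two, ← hsum, mul_assoc 2, mul_div_cancel_left₀ _ (two_ne_zero' ℝ)] at hgeom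
  have hle := Real.norm_exp_I_mul_ofReal_sub_one_le (x := φ)
  rw [Real.norm_eq_abs, hφ, abs_div, abs_of_pos hM', mul_assoc 2, abs_mul, abs_two] at hle
  have hmul := mul_le_mul_of_nonneg_left hle
    (norm_nonneg (∑ j : Fin M, Complex.exp ((j : ℕ) * φ * Complex.I)))
  rw [← mul_assoc 2, ← hφ, hgeom, mul_div_assoc', le_div_iff₀ hM'] at hmul
  linarith

theorem one_sub_sq_div_six_le_sinc (y : ℝ) : 1 - y ^ 2 / 6 ≤ Real.sinc y := by
  wlog hy : 0 ≤ y generalizing y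
  · simpa using this (-y) (by linarith)
  rcases hy.eq_or_lt with rfl | hy
  · simp
  rw [Real.sinc_of_ne_zero hy.ne', le_div_iff₀ hy]
  linarith [Real.sin_ge_sub_cube hy.le]

/-- This bounds the mass of the two grid points at distances `x` and `1 - x` from the centre. At `x
= 1/2` the sum is `8/π² ≈ 0.81`, which leaves room for crude estimates. -/
theorem sinc_sq_add_sinc_sq_ge {x : ℝ} (h0 : 0 ≤ x) (h1 : x ≤ 1) :
    3 / 4 ≤ Real.sinc (Real.pi * x) ^ 2 + Real.sinc (Real.pi * (1 - x)) ^ 2 := by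
  wlog hx : x ≤ 1 / 2 generalizing x
  · have := this (x := 1 - x) (by linarith) (by linarith) (by linarith)
    rw [sub_sub_cancel] at this
    linarith
  have hp1 := Real.pi_gt_d2
  have hp2 := Real.pi_lt_d2
  have hpp : Real.pi ^ 2 < 9.9225 := by nlinarith
  -- Up to `11/40` the nearer point alone suffices, through `sinc y ≥ 1 - y²/6`. Beyond that, both
  -- sines equal `cos (πu)` with `u = 1/2 - x`, and `cos² ≥ 1 - π²u²` reduces the claim to a
  -- polynomial inequality in `w = u²`; here `9.9225 = 3.15²` bounds `π²`.
  rcases le_total x (11 / 40) with h | h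
  · have h2 : (Real.pi * x) ^ 2 ≤ 3 / 4 + 1 / 2000 := by
      rw [mul_pow]
      have : x ^ 2 ≤ (11 / 40) ^ 2 := by gcongr
      nlinarith [sq_nonneg x]
    have h3 := one_sub_sq_div_six_le_sinc (Real.pi * x)
    nlinarith [sq_nonneg (Real.sinc (Real.pi * (1 - x)))]
  · set u := 1 / 2 - x with hu
    have hu0 : 0 ≤ u := by linarith
    have hu1 : u ≤ 9 / 40 := by linarith
    have hsin : Real.sin (Real.pi * x) = Real.cos (Real.pi * u) := by
      rw [← Real.cos_pi_div_two_sub, hu]; ring_nf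
    have hsin' : Real.sin (Real.pi * (1 - x)) = Real.cos (Real.pi * u) := by
      rw [← hsin, ← Real.sin_pi_sub]; ring_nf
    have hx0 : 0 < x := by linarith
    have hx1 : 0 < 1 - x := by linarith
    rw [Real.sinc_of_ne_zero (by positivity), Real.sinc_of_ne_zero (by positivity), hsin, hsin']
    have hxu : x = 1 / 2 - u := by linarith
    have hc : 1 - Real.pi ^ 2 * u ^ 2 ≤ Real.cos (Real.pi * u) ^ 2 := by
      rw [Real.cos_sq', ← mul_pow]
      linarith [Real.sin_sq_le_sq (x := Real.pi * u)]
    have hw : u ^ 2 ≤ (9 / 40) ^ 2 := by gcongr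
    set w := u ^ 2 with hwd
    have hw0 : 0 ≤ w := sq_nonneg u
    have heq : (Real.cos (Real.pi * u) / (Real.pi * x)) ^ 2 +
        (Real.cos (Real.pi * u) / (Real.pi * (1 - x))) ^ 2 =
        Real.cos (Real.pi * u) ^ 2 * (8 * (1 + 4 * w)) / (Real.pi ^ 2 * (1 - 4 * w) ^ 2) := by
      have h4 : 1 - 4 * w = 4 * (x * (1 - x)) := by rw [hwd, hxu]; ring
      have h5 : 8 * (1 + 4 * w) = 16 * (x ^ 2 + (1 - x) ^ 2) := by rw [hwd, hxu]; ring
      rw [h4, h5]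
      field_simp
      ring
    have h6 : 0 < 1 - 4 * w := by nlinarith
    rw [heq, le_div_iff₀ (by positivity)]
    have h7 : (1 - 9.9225 * w) * (8 * (1 + 4 * w)) ≤
        Real.cos (Real.pi * u) ^ 2 * (8 * (1 + 4 * w)) := by
      gcongr
      nlinarith
    have h8 : 3 / 4 * (Real.pi ^ 2 * (1 - 4 * w) ^ 2) ≤ 3 / 4 * (9.9225 * (1 - 4 * w) ^ 2) := by
      gcongr
    nlinarith

/-- The observed values close to the angle of the kernel carry at least three quarters of its
mass. -/
theorem sum_fejer_ge (M : ℕ) (hM : 2 ≤ M) (θ : ℝ) (G : Fin M → Prop) [DecidablePred G]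
    (hG : ∀ (y : Fin M) (q : ℤ), |θ - Real.pi * (y : ℕ) / M - q * Real.pi| ≤ Real.pi / M → G y) :
    3 / 4 ≤ ∑ y, if G y then fejer M (2 * θ - 2 * Real.pi * (y : ℕ) / M) else 0 := by
  have hM' : (0 : ℝ) < M := by positivity
  have hpi := Real.pi_pos
  -- `α` is the centre in units of the grid. Its neighbours `⌊α⌋` and `⌊α⌋ + 1` are reduced modulo
  -- `M`, which shifts the angle by a multiple of `π`; they stay distinct because `M ≥ 2`.
  set α : ℝ := M * θ / Real.pi with hα
  have hθ : θ = α * Real.pi / M := by rw [hα]; field_simp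
  have key : ∀ k : ℤ, |α - k| ≤ 1 → ∃ y : Fin M, ((y : ℕ) : ℤ) = k % M ∧ G y ∧
      Real.sinc (Real.pi * (α - k)) ^ 2 ≤ fejer M (2 * θ - 2 * Real.pi * (y : ℕ) / M) := by
    intro k hk
    have hM0 : (M : ℤ) ≠ 0 := by omega
    have hmod0 := Int.emod_nonneg k hM0
    have hmod1 := Int.emod_lt_of_pos k (show (0 : ℤ) < M by omega)
    refine ⟨⟨(k % M).toNat, by omega⟩, Int.toNat_of_nonneg hmod0, ?_, ?_⟩
    all_goals
      have hcast : (((k % M).toNat : ℕ) : ℝ) = k - M * (k / M : ℤ) := by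
        have h1 : (((k % M).toNat : ℕ) : ℤ) = k - M * (k / M) := by
          rw [Int.toNat_of_nonneg hmod0]
          linarith [Int.emod_add_mul_ediv k M]
        exact_mod_cast congrArg (Int.cast : ℤ → ℝ) h1
    · refine hG _ (k / M) ?_
      have : θ - Real.pi * (((k % M).toNat : ℕ) : ℝ) / M - (k / M : ℤ) * Real.pi =
          Real.pi / M * (α - k) := by
        rw [hcast, hθ]
        field_simp
        ring
      rw [this, abs_mul, abs_of_pos (by positivity)]
      exact mul_le_of_le_one_right (by positivity) hk
    · have : 2 * θ - 2 * Real.pi * (((k % M).toNat : ℕ) : ℝ) / M =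
          2 * Real.pi * (α - k) / M + 2 * Real.pi * (k / M : ℤ) := by
        rw [hcast, hθ]
        field_simp
        ring
      rw [this, fejer_add_two_pi_mul_int]
      exact sinc_sq_le_fejer M (by omega) _
  have hf0 := Int.fract_nonneg α
  have hf1 := (Int.fract_lt_one α).le
  have e0 : α - ⌊α⌋ = Int.fract α := Int.self_sub_floor α
  have e1 : α - (⌊α⌋ + 1 : ℤ) = -(1 - Int.fract α) := by push_cast; linarith
  obtain ⟨y₀, hy₀, hG₀, hs₀⟩ := key ⌊α⌋ (by rw [e0, abs_of_nonneg hf0]; exact hf1)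
  obtain ⟨y₁, hy₁, hG₁, hs₁⟩ := key (⌊α⌋ + 1)
    (by rw [e1, abs_neg, abs_of_nonneg (by linarith)]; linarith)
  have hne : y₀ ≠ y₁ := by
    rintro rfl
    have h1 : (M : ℤ) ∣ ⌊α⌋ + 1 - ⌊α⌋ := Int.ModEq.dvd (show ⌊α⌋ % M = _ from hy₀ ▸ hy₁)
    rw [add_sub_cancel_left] at h1
    have := Int.le_of_dvd one_pos h1
    omega
  rw [e0] at hs₀
  rw [e1, mul_neg, Real.sinc_neg] at hs₁
  refine (sinc_sq_add_sinc_sq_ge hf0 hf1).trans ((add_le_add hs₀ hs₁).trans ?_)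
  have := Finset.sum_le_sum_of_subset_of_nonneg (Finset.subset_univ {y₀, y₁})
    (f := fun y : Fin M => if G y then fejer M (2 * θ - 2 * Real.pi * (y : ℕ) / M) else 0)
    fun y _ _ => by
      split_ifs
      · exact fejer_nonneg _ _
      · exact le_rfl
  rwa [Finset.sum_pair hne, if_pos hG₀, if_pos hG₁] at this

/-- The difference factors as `sin (a - b) sin (a + b)`. A grid error in the angle thus bounds the
error of the estimate directly. -/
theorem abs_sin_sq_sub_sin_sq_le (a b : ℝ) : |Real.sin a ^ 2 - Real.sin b ^ 2| ≤ |a - b| := by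
  have h : Real.sin a ^ 2 - Real.sin b ^ 2 = Real.sin (a - b) * Real.sin (a + b) := by
    rw [Real.sin_sub, Real.sin_add]
    nlinarith [Real.sin_sq_add_cos_sq a, Real.sin_sq_add_cos_sq b]
  rw [h, abs_mul]
  exact (mul_le_of_le_one_right (abs_nonneg _) (Real.abs_sin_le_one _)).trans Real.abs_sin_le_abs

theorem estimationQubits_spec (ε : ℝ) :
    3 * Real.pi / (2 * ε) ≤ (2 ^ estimationQubits ε : ℕ) :=
  (Nat.le_ceil _).trans (Nat.cast_le.mpr (Nat.le_pow_clog one_lt_two _))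

open Classical in
/-- A run of amplitude estimation errs by `ε` or more with probability at most `1 / 4`. -/
theorem amplitudeEstimation_accuracy {n : ℕ} (A : Matrix.unitaryGroup (Bits n) ℂ)
    (ini : PureState n) (out : Fin n) (w : Word n) {ε : ℝ} (hε : 0 < ε) (hε' : ε ≤ 1 / 2) :
    3 / 4 ≤ ∑ y, if |estimate (estimationQubits ε) y -
        acceptanceProb (Word.unitary A w) ini out| < ε then
      (ampEstCircuit ini out w (2 ^ estimationQubits ε)).measureProb A ini y else 0 := by
  have hpi := Real.pi_gt_three
  have hspec := estimationQubits_spec ε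
  generalize estimationQubits ε = m at hspec ⊢
  obtain ⟨θ, hθ⟩ : ∃ θ, acceptanceProb (Word.unitary A w) ini out = Real.sin θ ^ 2 := by
    refine ⟨Real.arcsin (√(acceptanceProb (Word.unitary A w) ini out)), ?_⟩
    rw [Real.sin_arcsin (by linarith [Real.sqrt_nonneg (acceptanceProb (Word.unitary A w) ini out)])
      (Real.sqrt_le_one.mpr (acceptanceProb_le_one _ _ _)),
      Real.sq_sqrt (acceptanceProb_nonneg _ _ _)]
  rw [div_le_iff₀ (by positivity)] at hspec
  have hM : 2 ≤ 2 ^ m := by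
    have : (2 : ℝ) ≤ (2 ^ m : ℕ) := by nlinarith [Nat.cast_nonneg (α := ℝ) (2 ^ m)]
    exact_mod_cast this
  have hMpos : (0 : ℝ) < (2 ^ m : ℕ) := by positivity
  -- The choice `2^m ≥ 3π/(2ε)` even gives `π/2^m ≤ 2ε/3`; the slack makes the error strictly
  -- smaller than `ε`.
  have hπM : Real.pi / (2 ^ m : ℕ) < ε := by
    rw [div_lt_iff₀ hMpos]
    nlinarith
  have hclose : ∀ σ : ℝ, Real.sin σ ^ 2 = Real.sin θ ^ 2 → ∀ (y : Fin (2 ^ m)) (q : ℤ),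
      |σ - Real.pi * (y : ℕ) / (2 ^ m : ℕ) - q * Real.pi| ≤ Real.pi / (2 ^ m : ℕ) →
      |estimate m y - Real.sin θ ^ 2| < ε := by
    intro σ hσ y q h
    have hq : Real.sin (Real.pi * (y : ℕ) / (2 ^ m : ℕ) + q * Real.pi) ^ 2 = estimate m y := by
      rw [Real.sin_add_int_mul_pi, mul_pow, estimate, ← abs_sq ((-1 : ℝ) ^ q)]
      simp
    rw [← hq, ← hσ]
    refine (abs_sin_sq_sub_sin_sq_le _ _).trans_lt (lt_of_le_of_lt ?_ hπM)
    rwa [abs_sub_comm, ← sub_sub]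
  have h1 := sum_fejer_ge (2 ^ m) hM θ (fun y => |estimate m y - Real.sin θ ^ 2| < ε)
    (hclose θ rfl)
  have h2 := sum_fejer_ge (2 ^ m) hM (-θ) (fun y => |estimate m y - Real.sin θ ^ 2| < ε)
    (hclose (-θ) (by rw [Real.sin_neg, neg_sq]))
  rw [hθ]
  have h3 := add_le_add h1 h2
  rw [← Finset.sum_add_distrib] at h3
  have h4 := div_le_div_of_nonneg_right h3 (zero_le_two (α := ℝ))
  rw [Finset.sum_div] at h4
  refine le_trans (by norm_num) (h4.trans (Finset.sum_le_sum fun y _ => ?_))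
  split_ifs
  · exact (measureProb_eq_fejer A ini out w θ hθ y).ge
  · simp

/-! ### The median trick -/

theorem succ_le_countP_of_lower {l : List ℝ} (hl : l.Pairwise (· ≤ ·)) (bad : ℝ → Bool)
    (hbad : ∀ x y, x ≤ y → bad y = true → bad x = true) (i : ℕ) (hi : i < l.length)
    (h : bad l[i] = true) : i + 1 ≤ l.countP bad := by
  have hall : ∀ a ∈ l.take (i + 1), bad a = true := by
    intro a ha
    obtain ⟨j, hj, rfl⟩ := List.mem_iff_getElem.mp ha
    rw [List.getElem_take]
    rw [List.length_take] at hj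
    refine hbad _ _ ?_ h
    rcases (show j ≤ i by omega).eq_or_lt with rfl | hlt
    · exact le_rfl
    · exact List.pairwise_iff_getElem.mp hl _ _ _ _ hlt
  have := (List.take_sublist (i + 1) l).countP_le (p := bad)
  rw [List.countP_eq_length.mpr hall, List.length_take] at this
  omega

theorem sub_le_countP_of_upper {l : List ℝ} (hl : l.Pairwise (· ≤ ·)) (bad : ℝ → Bool)
    (hbad : ∀ x y, x ≤ y → bad x = true → bad y = true) (i : ℕ) (hi : i < l.length)
    (h : bad l[i] = true) : l.length - i ≤ l.countP bad := by
  have hall : ∀ a ∈ l.drop i, bad a = true := by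
    intro a ha
    obtain ⟨j, hj, rfl⟩ := List.mem_iff_getElem.mp ha
    rw [List.length_drop] at hj
    rw [List.getElem_drop]
    refine hbad _ _ ?_ h
    rcases j.eq_zero_or_pos with rfl | hlt
    · exact le_rfl
    · exact List.pairwise_iff_getElem.mp hl _ _ _ _ (by omega)
  have := (List.drop_sublist i l).countP_le (p := bad)
  rwa [List.countP_eq_length.mpr hall, List.length_drop] at this

/-- If the median lies in an upper or a lower set, then so do at least half of the entries. -/
theorem length_le_two_mul_countP (l : List ℝ) (bad : ℝ → Bool)
    (hbad : (∀ x y, x ≤ y → bad y = true → bad x = true) ∨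
      (∀ x y, x ≤ y → bad x = true → bad y = true)) (h : bad (median l) = true) :
    l.length ≤ 2 * l.countP bad := by
  rcases Nat.eq_zero_or_pos l.length with h0 | h0
  · omega
  have hlen : (l.insertionSort (· ≤ ·)).length = l.length := List.length_insertionSort _ _
  have hcount : (l.insertionSort (· ≤ ·)).countP bad = l.countP bad :=
    (List.perm_insertionSort _ _).countP_eq _
  have hi : l.length / 2 < (l.insertionSort (· ≤ ·)).length := by omega
  rw [median, List.getD_eq_getElem _ _ hi] at h
  have hs : (l.insertionSort (· ≤ ·)).Pairwise (· ≤ ·) := List.pairwise_insertionSort _ _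
  -- In the sorted list, a bad entry at index `⌊r/2⌋` makes all entries before it bad (lower set) or
  -- all after it bad (upper set): `⌊r/2⌋ + 1` or `⌈r/2⌉` entries, at least half either way.
  rcases hbad with hb | hb
  · have := succ_le_countP_of_lower hs bad hb _ hi h
    omega
  · have := sub_le_countP_of_upper hs bad hb _ hi h
    omega

section

variable {n : ℕ} (A : Matrix.unitaryGroup (Bits n) ℂ) (ini : PureState n) (out : Fin n)
  (w : Word n)

/-- For iterations whose estimate is irrelevant: a bound valid for every estimate survives averaging
over the outcomes. -/
theorem le_outputProb_estimateRounds (m : ℕ) (k : ℝ → Program n) (b : Bool) (c : ℝ)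
    (hk : ∀ p, c ≤ (k p).outputProb A ini b) (r : ℕ) (acc : List ℝ) :
    c ≤ (estimateRounds ini out w m k r acc).outputProb A ini b := by
  induction r generalizing acc with
  | zero => exact hk _
  | succ r ih =>
    rw [estimateRounds, Program.outputProb]
    calc c = ∑ y, (ampEstCircuit ini out w (2 ^ m)).measureProb A ini y * c := by
          rw [← Finset.sum_mul, Circuit.sum_measureProb, one_mul]
      _ ≤ _ := Finset.sum_le_sum fun y _ =>
          mul_le_mul_of_nonneg_left (ih _) (Circuit.measureProb_nonneg _ _ _ _)

/-- Chernoff's bound for the median of independent runs, by the exponential moment of the number of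
bad estimates. -/
theorem chernoff_le_outputProb_estimateRounds (m : ℕ) (k : ℝ → Program n) (b : Bool) (c : ℝ)
    (hc : 0 ≤ c) (bad : ℝ → Bool)
    (hbad : (∀ x y, x ≤ y → bad y = true → bad x = true) ∨
      (∀ x y, x ≤ y → bad x = true → bad y = true))
    (hk : ∀ p, bad p = false → c ≤ (k p).outputProb A ini b)
    (hprob : 3 / 4 ≤ ∑ y, if bad (estimate m y) = false then
      (ampEstCircuit ini out w (2 ^ m)).measureProb A ini y else 0) (r : ℕ) (acc : List ℝ) :
    c * (1 - (3 / 2) ^ r * 3 ^ acc.countP bad / √3 ^ (r + acc.length)) ≤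
      (estimateRounds ini out w m k r acc).outputProb A ini b := by
  -- One run multiplies the expected value of `3^(#bad)` by at most `3/4 · 1 + 1/4 · 3 = 3/2`, while
  -- a bad median among `N` estimates forces `3^(#bad) ≥ √3^N`. The accumulator must be general for
  -- the induction to pass through the runs.
  induction r generalizing acc with
  | zero =>
    rw [estimateRounds, pow_zero, one_mul, zero_add]
    cases hb : bad (median acc) with
    | false => exact (mul_le_of_le_one_right hc (sub_le_self _ (by positivity))).trans (hk _ hb)
    | true =>
      refine le_trans (mul_nonpos_of_nonneg_of_nonpos hc (sub_nonpos.mpr ?_))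
        (Program.outputProb_nonneg _ _ _ _)
      rw [one_le_div (by positivity)]
      calc √3 ^ acc.length ≤ √3 ^ (2 * acc.countP bad) :=
            pow_le_pow_right₀ (Real.one_le_sqrt.mpr (by norm_num))
              (length_le_two_mul_countP acc bad hbad hb)
        _ = 3 ^ acc.countP bad := by rw [pow_mul, Real.sq_sqrt (by norm_num)]
  | succ r ih =>
    rw [estimateRounds, Program.outputProb]
    set P := (ampEstCircuit ini out w (2 ^ m)).measureProb A ini with hP
    have hP1 : ∑ y, P y = 1 := Circuit.sum_measureProb _ _ _
    set K : ℝ := (3 / 2) ^ r * 3 ^ acc.countP bad / √3 ^ (r + 1 + acc.length) with hK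
    have hK0 : 0 ≤ K := by positivity
    -- The inductive bound is `c(1 - K)` after a good estimate and `c(1 - 3K)` after a bad one,
    -- written as one affine function of the indicator of good.
    have hstep : ∀ y, P y * (c * (1 - K * 3)) +
        c * K * 2 * (if bad (estimate m y) = false then P y else 0) ≤
        P y * (estimateRounds ini out w m k r (estimate m y :: acc)).outputProb A ini b := by
      intro y
      have h1 := mul_le_mul_of_nonneg_left (ih (estimate m y :: acc))
        (Circuit.measureProb_nonneg A ini (ampEstCircuit ini out w (2 ^ m)) y)
      refine le_trans (le_of_eq ?_) h1
      rw [List.length_cons, ← add_assoc, add_right_comm r, ← hP]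
      cases hb : bad (estimate m y) with
      | false =>
        rw [List.countP_cons_of_neg (by simp [hb]), ← hK, if_pos rfl]
        ring
      | true =>
        rw [List.countP_cons_of_pos (by simp [hb]), if_neg (by simp), hK]
        ring
    refine le_trans ?_ (Finset.sum_le_sum fun y _ => hstep y)
    rw [Finset.sum_add_distrib, ← Finset.sum_mul, hP1, ← Finset.mul_sum]
    have h2 := mul_le_mul_of_nonneg_left hprob (mul_nonneg (mul_nonneg hc hK0) zero_le_two)
    have h3 : (3 / 2 : ℝ) ^ (r + 1) * 3 ^ acc.countP bad / √3 ^ (r + 1 + acc.length) =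
        3 / 2 * K := by rw [hK]; ring
    rw [h3]
    linarith

/-- The factor 7 in the number of rounds works because `√3/2 ≤ exp (-1/7)`, which after raising to
the 14th power reads `(3/4)^7 ≤ exp (-2)`. -/
theorem chernoff_rate_pow_le {η : ℝ} (h0 : 0 < η) :
    (3 / 2) ^ estimationRounds η / √3 ^ estimationRounds η ≤ η := by
  have h3 : √3 ^ 2 = 3 := Real.sq_sqrt (by norm_num)
  have hbase : (3 / 2 : ℝ) / √3 ≤ Real.exp (-(1 / 7)) := by
    refine le_of_pow_le_pow_left₀ (n := 14) (by norm_num) (Real.exp_pos _).le ?_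
    rw [← Real.exp_nat_mul, div_pow, show √3 ^ 14 = (√3 ^ 2) ^ 7 by ring, h3,
      show ((14 : ℕ) : ℝ) * -(1 / 7) = -((2 : ℕ) * 1) by norm_num, Real.exp_neg, Real.exp_nat_mul,
      le_inv_comm₀ (by norm_num) (by positivity)]
    calc Real.exp 1 ^ 2 ≤ 2.7182818286 ^ 2 := by gcongr; exact Real.exp_one_lt_d9.le
      _ ≤ _ := by norm_num
  rw [← div_pow]
  calc ((3 / 2 : ℝ) / √3) ^ estimationRounds η
      ≤ Real.exp (-(1 / 7)) ^ estimationRounds η := by gcongr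
    _ = Real.exp (-(estimationRounds η / 7)) := by rw [← Real.exp_nat_mul]; ring_nf
    _ ≤ Real.exp (-Real.log (1 / η)) := by
        have := Nat.le_ceil (7 * Real.log (1 / η))
        rw [Real.exp_le_exp]
        unfold estimationRounds
        linarith
    _ = η := by rw [one_div, Real.log_inv, neg_neg, Real.exp_log h0]

/-- Correctness of additive amplitude estimation, for continuations that answer as wanted on every
estimate outside of an upper or a lower set. -/
theorem le_outputProb_additiveAmpEst {ε η : ℝ} (hε : 0 < ε) (hε' : ε ≤ 1 / 2) (hη : 0 < η)
    (k : ℝ → Program n) (b : Bool) (c : ℝ) (hc : 0 ≤ c) (bad : ℝ → Bool)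
    (hbad : (∀ x y, x ≤ y → bad y = true → bad x = true) ∨
      (∀ x y, x ≤ y → bad x = true → bad y = true))
    (hk : ∀ p, bad p = false → c ≤ (k p).outputProb A ini b)
    (hgood : ∀ p, |p - acceptanceProb (Word.unitary A w) ini out| < ε → bad p = false) :
    c * (1 - η) ≤ (additiveAmpEst ini out w ε η k).outputProb A ini b := by
  have hprob := (amplitudeEstimation_accuracy A ini out w hε hε').trans
    (Finset.sum_le_sum (g := fun y => if bad (estimate (estimationQubits ε) y) = false then
      (ampEstCircuit ini out w (2 ^ estimationQubits ε)).measureProb A ini y else 0) fun y _ => by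
      split_ifs with h1 h2
      · exact le_rfl
      · exact absurd (hgood _ h1) h2
      · exact Circuit.measureProb_nonneg _ _ _ _
      · exact le_rfl)
  have h := chernoff_le_outputProb_estimateRounds A ini out w _ k b c hc bad hbad hk hprob
    (estimationRounds η) []
  refine le_trans (mul_le_mul_of_nonneg_left (sub_le_sub_left ?_ 1) hc) h
  simpa using chernoff_rate_pow_le hη

/-! ### The loop -/

/-- Only iteration `j` has to estimate well: an earlier one either accepts, which is already right,
or passes on. Hence a single `η` is lost. -/
theorem le_outputProb_separationLoop_true {ε η θ : ℝ} (hε : 0 < ε) (hε' : ε ≤ 1 / 2)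
    (hη : 0 < η) (r i j : ℕ) (hij : i ≤ j) (hj : j < i + r)
    (h : θ + ε ≤
      acceptanceProb (Word.unitary A (amplified ini out ((3 ^ j - 1) / 2))) ini out) :
    1 - η ≤ (separationLoop ini out ε η θ i r).outputProb A ini true := by
  induction r generalizing i with
  | zero => omega
  | succ r ih =>
    rw [separationLoop]
    rcases hij.eq_or_lt with rfl | hlt
    · classical
      rw [← one_mul (1 - η)]
      refine le_outputProb_additiveAmpEst A ini out _ hε hε' hη _ true 1 zero_le_one
        (fun p => decide (p < θ)) (Or.inl fun x y hxy hy => ?_) (fun p hp => ?_) fun p hp => ?_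
      · exact decide_eq_true (hxy.trans_lt (of_decide_eq_true hy))
      · rw [if_pos (not_lt.mp (of_decide_eq_false hp))]
        simp [Program.outputProb]
      · exact decide_eq_false (by linarith [(abs_lt.mp hp).1])
    · refine le_outputProb_estimateRounds A ini out _ _ _ true _ (fun p => ?_) _ _
      split_ifs
      · simpa [Program.outputProb] using hη.le
      · exact ih (i + 1) hlt (by omega)

/-- No iteration may accept, and each run is on fresh registers, so the success probabilities
multiply. Errors strictly below `ε` keep the estimate strictly below `θ`, as acceptance at equality
demands. -/
theorem le_outputProb_separationLoop_false {ε η θ : ℝ} (hε : 0 < ε) (hε' : ε ≤ 1 / 2)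
    (hη : 0 < η) (hη' : η ≤ 1) (r i : ℕ)
    (h : ∀ j, j < i + r →
      acceptanceProb (Word.unitary A (amplified ini out ((3 ^ j - 1) / 2))) ini out ≤ θ - ε) :
    (1 - η) ^ r ≤ (separationLoop ini out ε η θ i r).outputProb A ini false := by
  induction r generalizing i with
  | zero => simp [separationLoop, Program.outputProb]
  | succ r ih =>
    rw [separationLoop, pow_succ]
    have hi := h i (by omega)
    refine le_outputProb_additiveAmpEst A ini out _ hε hε' hη _ false _
      (pow_nonneg (by linarith) _) (fun p => decide (θ ≤ p))
      (Or.inr fun x y hxy hx => ?_) (fun p hp => ?_) fun p hp => ?_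
    · exact decide_eq_true ((of_decide_eq_true hx).trans hxy)
    · rw [if_neg (of_decide_eq_false hp)]
      exact ih (i + 1) fun j hj => h j (by omega)
    · exact decide_eq_false (not_le.mpr (by linarith [(abs_lt.mp hp).2]))

end

/-! ### Angles and levels -/

theorem sin_tau {t : ℝ} (ht : t ≤ 1) : Real.sin (tau t) = √t :=
  Real.sin_arcsin (by linarith [Real.sqrt_nonneg t]) (Real.sqrt_le_one.mpr ht)

theorem sin_tau_sq {t : ℝ} (ht0 : 0 ≤ t) (ht : t ≤ 1) : Real.sin (tau t) ^ 2 = t := by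
  rw [sin_tau ht, Real.sq_sqrt ht0]

theorem tau_pos {t : ℝ} (ht : 0 < t) : 0 < tau t :=
  Real.arcsin_pos.mpr (Real.sqrt_pos.mpr ht)

theorem tau_nonneg (t : ℝ) : 0 ≤ tau t := Real.arcsin_nonneg.mpr (Real.sqrt_nonneg t)

theorem tau_le_pi_div_two (t : ℝ) : tau t ≤ Real.pi / 2 := Real.arcsin_le_pi_div_two _

theorem tau_mono {s t : ℝ} (h : s ≤ t) : tau s ≤ tau t :=
  Real.monotone_arcsin (Real.sqrt_le_sqrt h)

theorem tau_half : tau (1 / 2) = Real.pi / 4 := by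
  have h : √(1 / 2 : ℝ) = Real.sin (Real.pi / 4) := by
    rw [Real.sin_pi_div_four, Real.sqrt_div zero_le_one, Real.sqrt_one, div_eq_div_iff (by positivity)
      two_ne_zero, Real.mul_self_sqrt zero_le_two, one_mul]
  rw [tau, h, Real.arcsin_sin (by linarith [Real.pi_pos]) (by linarith [Real.pi_pos])]

theorem lastIter_of_half_lt {t : ℝ} (ht : 1 / 2 < t) : lastIter t = 0 := by
  have h := tau_mono ht.le
  rw [tau_half] at h
  have hpi := Real.pi_pos
  refine Nat.floor_eq_zero.mpr (lt_of_le_of_lt ?_ one_pos)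
  refine Real.logb_nonpos (by norm_num) (by positivity [tau_nonneg t]) ?_
  rw [div_le_one (by linarith)]
  linarith

theorem pow_lastIter_mul_tau_le {t : ℝ} (ht0 : 0 < t) (ht : t ≤ 1 / 2) :
    3 ^ lastIter t * tau t ≤ Real.pi / 4 := by
  have hτ := tau_pos ht0
  have hpi := Real.pi_pos
  have h := tau_mono ht
  rw [tau_half] at h
  have hx : 0 < Real.pi / (4 * tau t) := by positivity
  have hlog : 0 ≤ Real.logb 3 (Real.pi / (4 * tau t)) := by
    refine Real.logb_nonneg (by norm_num) ?_
    rw [one_le_div (by positivity)]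
    linarith
  have h1 := Nat.floor_le hlog
  rw [Real.le_logb_iff_rpow_le (by norm_num) hx, Real.rpow_natCast, le_div_iff₀ (by positivity)]
    at h1
  unfold lastIter
  linarith

theorem lt_pow_lastIter_mul_tau {t : ℝ} (ht0 : 0 < t) :
    Real.pi / 12 < 3 ^ lastIter t * tau t := by
  have hτ := tau_pos ht0
  have hpi := Real.pi_pos
  have hx : 0 < Real.pi / (4 * tau t) := by positivity
  have h1 := Nat.lt_floor_add_one (Real.logb 3 (Real.pi / (4 * tau t)))
  rw [← Nat.cast_add_one, Real.logb_lt_iff_lt_rpow (by norm_num) hx, Real.rpow_natCast,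
    div_lt_iff₀ (by positivity), pow_succ] at h1
  unfold lastIter
  linarith

theorem pow_lastIter_mul_tau_le_pi_div_two {t : ℝ} (ht0 : 0 < t) :
    3 ^ lastIter t * tau t ≤ Real.pi / 2 := by
  rcases le_or_gt t (1 / 2) with h | h
  · linarith [pow_lastIter_mul_tau_le ht0 h, Real.pi_pos]
  · rw [lastIter_of_half_lt h, pow_zero, one_mul]
    exact tau_le_pi_div_two t

theorem pow_lastIter_le {t : ℝ} (ht0 : 0 < t) (ht : t ≤ 1) : (3 : ℝ) ^ lastIter t ≤ 1 / √t := by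
  have hs : 0 < √t := Real.sqrt_pos.mpr ht0
  rw [le_div_iff₀ hs]
  rcases le_or_gt t (1 / 2) with h | h
  · have h1 := pow_lastIter_mul_tau_le ht0 h
    have h2 : √t ≤ tau t := by
      rw [← sin_tau ht]
      exact Real.sin_le (tau_nonneg t)
    have h3 : (3 : ℝ) ^ lastIter t * √t ≤ 3 ^ lastIter t * tau t := by gcongr
    linarith [Real.pi_lt_four]
  · rw [lastIter_of_half_lt h, pow_zero, one_mul]
    exact Real.sqrt_le_one.mpr ht

/-! ### The ratio `β` and the gap between the two levels -/

theorem beta_nonneg (t t' : ℝ) : 0 ≤ beta t t' := Real.sqrt_nonneg _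

theorem beta_lt_one {t t' : ℝ} (ht : 0 < t) (h : t' < t) : beta t t' < 1 := by
  rw [beta, Real.sqrt_lt' one_pos, one_pow, div_lt_one ht]
  exact h

theorem beta_mul_sqrt {t t' : ℝ} (ht' : 0 ≤ t') (ht : 0 < t) : beta t t' * √t = √t' := by
  rw [beta, Real.sqrt_div ht', div_mul_cancel₀ _ (Real.sqrt_pos.mpr ht).ne']

/-- Concavity of the sine on `[0, π]`, between `0` and `x`. Applied to `√t' = β sin τ`, it bounds
the angle of `t'` by `βτ`. -/
theorem mul_sin_le_sin_mul {b x : ℝ} (hb0 : 0 ≤ b) (hb1 : b ≤ 1) (hx0 : 0 ≤ x)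
    (hx : x ≤ Real.pi) : b * Real.sin x ≤ Real.sin (b * x) := by
  have h := strictConcaveOn_sin_Icc.concaveOn.2 (x := 0) (y := x)
    (Set.left_mem_Icc.mpr Real.pi_pos.le) ⟨hx0, hx⟩ (sub_nonneg.mpr hb1) hb0 (sub_add_cancel 1 b)
  simpa using h

/-- For `t ≤ 1/2` and `a = 3^s τ` the gap is `sin (a - βa) sin (a + βa)`. Jordan's inequality `sin x
≥ 2x/π` together with `a > π/12` bounds the factors below by `(1 - β)/6` and `1/6`. For `t > 1/2`
the gap is `t(1 - β)(1 + β)`. -/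
theorem one_sub_beta_le_level_sub {t t' : ℝ} (ht' : 0 < t') (h : t' < t) (ht : t ≤ 1) :
    (1 - beta t t') / 36 ≤ highLevel t - lowLevel t t' := by
  have ht0 : 0 < t := ht'.trans h
  have hβ0 := beta_nonneg t t'
  have hβ1 := beta_lt_one ht0 h
  have hpi := Real.pi_pos
  rw [highLevel, lowLevel]
  split_ifs with hhalf
  · have ha0 := lt_pow_lastIter_mul_tau ht0
    have ha1 := pow_lastIter_mul_tau_le ht0 hhalf
    rw [mul_left_comm]
    generalize (3 : ℝ) ^ lastIter t * tau t = a at *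
    generalize beta t t' = β at *
    have hapos : 0 < a := by linarith [Real.pi_pos]
    have hsq : Real.sin a ^ 2 - Real.sin (β * a) ^ 2 =
        Real.sin (a - β * a) * Real.sin (a + β * a) := by
      rw [Real.sin_sub, Real.sin_add]
      nlinarith [Real.sin_sq_add_cos_sq a, Real.sin_sq_add_cos_sq (β * a)]
    have hβa : 0 ≤ β * a := by positivity
    have hβa' : β * a ≤ a := by nlinarith
    have h1 := Real.mul_le_sin (x := a - β * a) (by linarith) (by linarith)
    have h2 := Real.mul_le_sin (x := a + β * a) (by linarith) (by linarith)
    have h3 : 1 / 6 * (1 - β) ≤ 2 / Real.pi * (a - β * a) := by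
      have : 1 / 6 ≤ 2 / Real.pi * a := by
        rw [div_mul_eq_mul_div, le_div_iff₀ hpi]
        linarith
      nlinarith
    have h4 : 1 / 6 ≤ 2 / Real.pi * (a + β * a) := by
      rw [div_mul_eq_mul_div, le_div_iff₀ hpi]
      linarith
    rw [hsq]
    calc (1 - β) / 36 = 1 / 6 * (1 - β) * (1 / 6) := by ring
      _ ≤ _ := mul_le_mul (h3.trans h1) (h4.trans h2) (by norm_num) (by linarith)
  · have hhalf := not_le.mp hhalf
    rw [lastIter_of_half_lt hhalf, pow_zero, one_mul, sin_tau_sq ht0.le ht]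
    have ht2 : t' = beta t t' ^ 2 * t := by
      rw [beta, Real.sq_sqrt (by positivity), div_mul_cancel₀ _ ht0.ne']
    have h1 : 1 / 2 ≤ t * (1 + beta t t') := by nlinarith
    nlinarith [mul_le_mul_of_nonneg_right h1 (sub_nonneg.mpr hβ1.le)]

theorem lowLevel_nonneg {t t' : ℝ} (ht' : 0 ≤ t') : 0 ≤ lowLevel t t' := by
  rw [lowLevel]
  split_ifs
  · positivity
  · exact ht'

theorem additiveError_le_half {t t' : ℝ} (ht' : 0 ≤ t') : additiveError t t' ≤ 1 / 2 := by
  have h1 : highLevel t ≤ 1 := Real.sin_sq_le_one _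
  have h2 := lowLevel_nonneg (t := t) ht'
  rw [additiveError]
  linarith

theorem one_sub_beta_le_additiveError {t t' : ℝ} (ht' : 0 < t') (h : t' < t) (ht : t ≤ 1) :
    (1 - beta t t') / 72 ≤ additiveError t t' := by
  have := one_sub_beta_le_level_sub ht' h ht
  rw [additiveError]
  linarith

theorem additiveError_pos {t t' : ℝ} (ht' : 0 < t') (h : t' < t) (ht : t ≤ 1) :
    0 < additiveError t t' := by
  have := one_sub_beta_le_additiveError ht' h ht
  linarith [beta_lt_one (ht'.trans h) h]

/-- A probability of at least `t` is amplified to the upper level in some iteration. -/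
theorem exists_highLevel_le {t p : ℝ} (ht0 : 0 < t) (htp : t ≤ p) :
    ∃ j ≤ lastIter t, highLevel t ≤ Real.sin (3 ^ j * tau p) ^ 2 := by
  have hpi := Real.pi_pos
  -- The witness is the least `j` whose amplified angle reaches `a = 3^s τ(t)`; minimality controls
  -- the overshoot.
  have hex : ∃ j, 3 ^ lastIter t * tau t ≤ 3 ^ j * tau p :=
    ⟨lastIter t, by gcongr; exact tau_mono htp⟩
  classical
  refine ⟨Nat.find hex, Nat.find_min' hex (by gcongr; exact tau_mono htp), ?_⟩
  have hspec := Nat.find_spec hex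
  have hmin := fun j => Nat.find_min hex (m := j)
  generalize Nat.find hex = j at hspec hmin
  have hτ : 0 < 3 ^ lastIter t * tau t := by positivity [tau_pos ht0]
  have hhigh := pow_lastIter_mul_tau_le_pi_div_two ht0
  have hsin0 : 0 ≤ Real.sin (3 ^ lastIter t * tau t) :=
    Real.sin_nonneg_of_nonneg_of_le_pi hτ.le (by linarith)
  rw [highLevel]
  refine pow_le_pow_left₀ hsin0 ?_ 2
  rcases le_total (3 ^ j * tau p) (Real.pi / 2) with hle | hge
  · exact Real.sin_le_sin_of_le_of_le_pi_div_two (by linarith) hle hspec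
  · rw [← Real.sin_pi_sub (3 ^ j * tau p)]
    refine Real.sin_le_sin_of_le_of_le_pi_div_two (by linarith) (by linarith) ?_
    rcases j with _ | j
    · rw [pow_zero, one_mul] at hge ⊢
      linarith [tau_le_pi_div_two p]
    -- The previous angle was below `a`, so this one is below `3a ≤ π - a` when `a ≤ π/4`. For `t >
    -- 1/2` nothing is amplified and the angle of `p` reaches `a` at once, so a positive index is
    -- impossible.
    · have h1 := not_le.mp (hmin j (Nat.lt_succ_self j))
      rw [pow_succ, mul_right_comm]
      rcases le_or_gt t (1 / 2) with h | h
      · linarith [pow_lastIter_mul_tau_le ht0 h]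
      · exfalso
        rw [lastIter_of_half_lt h, pow_zero, one_mul] at h1
        have h2 : (1 : ℝ) ≤ 3 ^ j := one_le_pow₀ (by norm_num)
        nlinarith [tau_mono htp, tau_nonneg p]

/-- A probability of at most `t'` stays below the lower level in all iterations. -/
theorem sin_sq_le_lowLevel {t t' p : ℝ} (ht' : 0 < t') (h : t' < t) (ht : t ≤ 1) (hp : 0 ≤ p)
    (hpt : p ≤ t') {j : ℕ} (hj : j ≤ lastIter t) :
    Real.sin (3 ^ j * tau p) ^ 2 ≤ lowLevel t t' := by
  have ht0 : 0 < t := ht'.trans h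
  have hβ0 := beta_nonneg t t'
  have hβ1 := beta_lt_one ht0 h
  have hpi := Real.pi_pos
  rw [lowLevel]
  split_ifs with hhalf
  · have hτ := tau_nonneg t
    have hle := pow_lastIter_mul_tau_le ht0 hhalf
    have hβτ : beta t t' * tau t ≤ Real.pi / 2 := by nlinarith [tau_le_pi_div_two t]
    have hτp : tau p ≤ beta t t' * tau t := by
      rw [← Real.arcsin_sin (x := beta t t' * tau t) (by linarith [mul_nonneg hβ0 hτ]) hβτ]
      refine Real.monotone_arcsin ((Real.sqrt_le_sqrt hpt).trans ?_)
      rw [← beta_mul_sqrt ht'.le ht0, ← sin_tau ht]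
      exact mul_sin_le_sin_mul hβ0 hβ1.le hτ (by linarith [tau_le_pi_div_two t])
    have h1 : 3 ^ j * tau p ≤ 3 ^ lastIter t * (beta t t' * tau t) := by
      gcongr
      · exact tau_nonneg p
      · norm_num
    have h2 : 3 ^ lastIter t * (beta t t' * tau t) ≤ Real.pi / 4 := by
      rw [mul_left_comm]
      nlinarith [mul_nonneg (pow_nonneg zero_le_three (lastIter t)) hτ]
    have h3 : 0 ≤ 3 ^ j * tau p := mul_nonneg (by positivity) (tau_nonneg p)
    exact pow_le_pow_left₀ (Real.sin_nonneg_of_nonneg_of_le_pi h3 (by linarith))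
      (Real.sin_le_sin_of_le_of_le_pi_div_two (by linarith) (by linarith) h1) 2
  · rw [lastIter_of_half_lt (not_le.mp hhalf), Nat.le_zero] at hj
    rw [hj, pow_zero, one_mul, sin_tau_sq hp (by linarith)]
    exact hpt

theorem acceptanceProb_amplified_pow {n : ℕ} (A : Matrix.unitaryGroup (Bits n) ℂ)
    (ini : PureState n) (out : Fin n) (j : ℕ) :
    acceptanceProb (Word.unitary A (amplified ini out ((3 ^ j - 1) / 2))) ini out =
      Real.sin (3 ^ j * tau (acceptanceProb A ini out)) ^ 2 := by
  have hodd : 2 * ((3 ^ j - 1) / 2) + 1 = 3 ^ j := by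
    have : Odd (3 ^ j) := Odd.pow (by decide)
    obtain ⟨k, hk⟩ := this
    omega
  rw [acceptanceProb_amplified A ini out (tau (acceptanceProb A ini out))
    (sin_tau_sq (acceptanceProb_nonneg _ _ _) (acceptanceProb_le_one _ _ _)).symm]
  congr 3
  exact_mod_cast hodd

/-! ### Correctness -/

theorem amplitudeSeparation_accepts {n : ℕ} (A : Matrix.unitaryGroup (Bits n) ℂ)
    (ini : PureState n) (out : Fin n) {t t' δ : ℝ} (ht' : 0 < t') (h : t' < t) (ht : t ≤ 1)
    (hδ : 0 < δ) (hp : t ≤ acceptanceProb A ini out) :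
    1 - δ ≤ (amplitudeSeparation ini out t t' δ).outputProb A ini true := by
  obtain ⟨j, hj, hhigh⟩ := exists_highLevel_le (ht'.trans h) hp
  have hη : 0 < δ / (1 + lastIter t) := by positivity
  have hη' : δ / (1 + lastIter t) ≤ δ := div_le_self hδ.le (by simp)
  refine le_trans (by linarith) (le_outputProb_separationLoop_true A ini out
    (additiveError_pos ht' h ht) (additiveError_le_half ht'.le) hη _ 0 j (Nat.zero_le j) (by omega) ?_)
  rw [acceptanceProb_amplified_pow]
  refine le_trans (le_of_eq ?_) hhigh
  rw [decisionThreshold, additiveError]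
  ring

theorem amplitudeSeparation_rejects {n : ℕ} (A : Matrix.unitaryGroup (Bits n) ℂ)
    (ini : PureState n) (out : Fin n) {t t' δ : ℝ} (ht' : 0 < t') (h : t' < t) (ht : t ≤ 1)
    (hδ : 0 < δ) (hδ1 : δ < 1) (hp : acceptanceProb A ini out ≤ t') :
    1 - δ ≤ (amplitudeSeparation ini out t t' δ).outputProb A ini false := by
  have hη : 0 < δ / (1 + lastIter t) := by positivity
  have hη' : δ / (1 + lastIter t) ≤ 1 := (div_le_self hδ.le (by simp)).trans hδ1.le
  refine le_trans ?_ (le_outputProb_separationLoop_false A ini out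
    (additiveError_pos ht' h ht) (additiveError_le_half ht'.le) hη hη' _ 0 fun j hj => ?_)
  -- Bernoulli's inequality: `(1 - δ/(1+s))^(s+1) ≥ 1 - δ`.
  · refine le_trans (le_of_eq ?_) (one_add_mul_le_pow
      (show -2 ≤ -(δ / (1 + lastIter t)) by linarith) (lastIter t + 1))
    push_cast
    field_simp
    ring
  · rw [acceptanceProb_amplified_pow]
    refine (sin_sq_le_lowLevel ht' h ht (acceptanceProb_nonneg _ _ _) hp (by omega)).trans
      (le_of_eq ?_)
    rw [decisionThreshold, additiveError]
    ring

/-! ### Query complexity -/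

/-- The number of calls to `A` or `A†` of a word. -/
def Word.calls {n : ℕ} (w : Word n) : ℕ := (w.map Op.calls).sum

theorem Word.calls_append {n : ℕ} (v w : Word n) :
    Word.calls (v ++ w) = Word.calls v + Word.calls w := by
  simp [Word.calls]

theorem Word.calls_inv {n : ℕ} (w : Word n) : Word.calls w.inv = Word.calls w := by
  have h : (Op.calls ∘ Op.inv : Op n → ℕ) = Op.calls := by
    funext o
    cases o <;> rfl
  simp [Word.calls, Word.inv, h]

theorem calls_groverWord {n : ℕ} (ini : PureState n) (out : Fin n) (w : Word n) :
    Word.calls (groverWord ini out w) = 2 * Word.calls w := by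
  rw [groverWord, Word.calls_append, Word.calls_append, Word.calls_append, Word.calls_inv]
  simp [Word.calls, Op.calls, two_mul]

theorem calls_amplified {n : ℕ} (ini : PureState n) (out : Fin n) (k : ℕ) :
    Word.calls (amplified ini out k) = 2 * k + 1 := by
  have h : ∀ w : Word n, Word.calls (List.replicate k w).flatten = k * Word.calls w := by
    intro w
    induction k with
    | zero => simp [Word.calls]
    | succ k ih => rw [List.replicate_succ, List.flatten_cons, Word.calls_append, ih]; ring
  rw [amplified, Word.calls_append, h, calls_groverWord]
  simp [Word.calls, Op.calls]
  ring

theorem Circuit.calls_append {n M : ℕ} (C D : Circuit n M) :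
    Circuit.calls (C ++ D) = Circuit.calls C + Circuit.calls D := by
  simp [Circuit.calls]

theorem Circuit.calls_map_control {n M : ℕ} (c : Fin M → Bool) (w : Word n) :
    Circuit.calls (w.map (Gate.control c)) = Word.calls w := by
  rw [Circuit.calls, Word.calls, List.map_map]
  rfl

theorem calls_ampEstCircuit_le {n : ℕ} (ini : PureState n) (out : Fin n) (w : Word n)
    (M : ℕ) [NeZero M] :
    Circuit.calls (ampEstCircuit ini out w M) ≤ 2 * M * Word.calls w := by
  have h : ∀ L, Circuit.calls ((List.range L).flatMap fun l => (groverWord ini out w).map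
      (Gate.control fun j : Fin M => decide (l < (j : ℕ)))) = L * (2 * Word.calls w) := by
    intro L
    induction L with
    | zero => simp [Circuit.calls]
    | succ L ih =>
      rw [List.range_succ, List.flatMap_append, Circuit.calls_append, ih, List.flatMap_singleton,
        Circuit.calls_map_control, calls_groverWord]
      ring
  have hreg : ∀ V : Matrix.unitaryGroup (Fin M) ℂ,
      Circuit.calls [(Gate.register V : Gate n M)] = 0 := fun _ => rfl
  rw [ampEstCircuit, Circuit.calls_append, Circuit.calls_append, Circuit.calls_append, hreg, hreg,
    h, Circuit.calls_map_control]
  obtain ⟨N, rfl⟩ := Nat.exists_eq_succ_of_ne_zero (NeZero.ne M)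
  rw [Nat.succ_sub_one, Nat.succ_eq_add_one]
  nlinarith

theorem calls_estimateRounds_le {n : ℕ} (ini : PureState n) (out : Fin n) (w : Word n) (m : ℕ)
    (k : ℝ → Program n) (D : ℕ) (hk : ∀ p, (k p).calls ≤ D) (r : ℕ) (acc : List ℝ) :
    (estimateRounds ini out w m k r acc).calls ≤ r * (2 * 2 ^ m * Word.calls w) + D := by
  induction r generalizing acc with
  | zero => simpa [estimateRounds] using hk (median acc)
  | succ r ih =>
    rw [estimateRounds, Program.calls]
    have h1 := calls_ampEstCircuit_le ini out w (2 ^ m)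
    have h2 := Finset.sup_le (s := Finset.univ) (fun y _ => ih (estimate m y :: acc))
    rw [add_mul, one_mul]
    omega

/-- Iteration `i` costs at most `R · 2M · 3^i` calls, and `2 · 3^i = 3^(i+1) - 3^i` telescopes. The
subtracted term stands on the left to avoid truncated subtraction. -/
theorem calls_separationLoop_le {n : ℕ} (ini : PureState n) (out : Fin n) (ε η θ : ℝ) (r i : ℕ) :
    (separationLoop ini out ε η θ i r).calls + estimationRounds η * 2 ^ estimationQubits ε * 3 ^ i ≤
      estimationRounds η * 2 ^ estimationQubits ε * 3 ^ (i + r) := by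
  induction r generalizing i with
  | zero => simp [separationLoop, Program.calls]
  | succ r ih =>
    have hodd : 2 * ((3 ^ i - 1) / 2) + 1 = 3 ^ i := by
      obtain ⟨k, hk⟩ : Odd (3 ^ i) := Odd.pow (by decide)
      omega
    have h := calls_estimateRounds_le ini out (amplified ini out ((3 ^ i - 1) / 2))
      (estimationQubits ε) (fun p => open Classical in if θ ≤ p then Program.ret true else
        separationLoop ini out ε η θ (i + 1) r) (separationLoop ini out ε η θ (i + 1) r).calls
      (fun p => by
        split_ifs
        · simp [Program.calls]
        · exact le_rfl) (estimationRounds η) []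
    rw [calls_amplified, hodd] at h
    have hi := ih (i + 1)
    rw [separationLoop, additiveAmpEst]
    rw [pow_succ 3 i, add_right_comm] at hi
    rw [← add_assoc]
    calc _ ≤ _ := Nat.add_le_add_right h _
      _ ≤ _ := by linarith

/-! ### Explicit constants in the query bound -/

theorem two_pow_estimationQubits_le {ε : ℝ} (hε : 0 < ε) (hε' : ε ≤ 1 / 2) :
    (2 : ℝ) ^ estimationQubits ε ≤ 18.9 / ε := by
  have hx1 : 1 < 3 * Real.pi / (2 * ε) := by
    rw [one_lt_div (by positivity)]
    linarith [Real.pi_gt_three]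
  have hceil : 1 < ⌈3 * Real.pi / (2 * ε)⌉₊ := by
    exact_mod_cast hx1.trans_le (Nat.le_ceil _)
  have h1 := Nat.pow_pred_clog_lt_self one_lt_two hceil
  have h2 : 0 < Nat.clog 2 ⌈3 * Real.pi / (2 * ε)⌉₊ := Nat.clog_pos one_lt_two hceil
  have h3 : 2 ^ estimationQubits ε ≤ 2 * ⌈3 * Real.pi / (2 * ε)⌉₊ := by
    rw [estimationQubits, ← Nat.succ_pred_eq_of_pos h2, pow_succ']
    exact Nat.mul_le_mul_left 2 h1.le
  -- With `x = 3π/(2ε) > 1`, minimality of `m` gives `2^m ≤ 2⌈x⌉ ≤ 4x = 6π/ε`, and `6 · 3.15 =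
  -- 18.9`.
  have h4 := Nat.ceil_lt_add_one (a := 3 * Real.pi / (2 * ε)) (by linarith)
  calc (2 : ℝ) ^ estimationQubits ε ≤ 2 * ⌈3 * Real.pi / (2 * ε)⌉₊ := by exact_mod_cast h3
    _ ≤ 4 * (3 * Real.pi / (2 * ε)) := by linarith
    _ = 6 * Real.pi / ε := by field_simp; ring
    _ ≤ _ := by gcongr; linarith [Real.pi_lt_d2]

theorem one_add_lastIter_le {t : ℝ} (ht0 : 0 < t) (ht : t ≤ 1) :
    1 + (lastIter t : ℝ) ≤ 1 / √t := by
  refine le_trans ?_ (pow_lastIter_le ht0 ht)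
  have := one_add_mul_le_pow (show (-2 : ℝ) ≤ 2 by norm_num) (lastIter t)
  norm_num at this
  linarith [Nat.cast_nonneg (α := ℝ) (lastIter t)]

theorem calls_amplitudeSeparation_le {n : ℕ} (ini : PureState n) (out : Fin n) {t t' δ : ℝ}
    (ht' : 0 < t') (h : t' < t) (ht : t ≤ 1) (hδ : 0 < δ) (hδ' : δ ≤ 1 / 2) :
    ((amplitudeSeparation ini out t t' δ).calls : ℝ) ≤
      40000 * (1 / ((1 - beta t t') * √t)) * Real.log ((1 + lastIter t) / δ) := by
  have ht0 := ht'.trans h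
  have hβ : 0 < 1 - beta t t' := sub_pos.mpr (beta_lt_one ht0 h)
  have hst : 0 < √t := Real.sqrt_pos.mpr ht0
  have hloop := (Nat.le_add_right _ _).trans (calls_separationLoop_le ini out (additiveError t t')
    (δ / (1 + lastIter t)) (decisionThreshold t t') (lastIter t + 1) 0)
  have hloop' : ((amplitudeSeparation ini out t t' δ).calls : ℝ) ≤
      estimationRounds (δ / (1 + lastIter t)) * 2 ^ estimationQubits (additiveError t t') *
        3 ^ (0 + (lastIter t + 1)) := by
    rw [amplitudeSeparation]
    exact_mod_cast hloop
  have hlog : 0.69 ≤ Real.log ((1 + lastIter t) / δ) := by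
    refine (by linarith [Real.log_two_gt_d9] : 0.69 ≤ Real.log 2).trans
      (Real.log_le_log two_pos ?_)
    rw [le_div_iff₀ hδ]
    linarith [Nat.cast_nonneg (α := ℝ) (lastIter t)]
  -- The ceiling costs at most 1, absorbed by `2 · 0.69`. Below, 1361 rounds up `18.9 · 72`, and `9
  -- · 1361 · 3 = 36747`.
  have hR : (estimationRounds (δ / (1 + lastIter t)) : ℝ) ≤
      9 * Real.log ((1 + lastIter t) / δ) := by
    rw [estimationRounds, one_div_div]
    linarith [Nat.ceil_lt_add_one (a := 7 * Real.log ((1 + lastIter t) / δ)) (by linarith)]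
  have hε := additiveError_pos ht' h ht
  have hM : (2 : ℝ) ^ estimationQubits (additiveError t t') ≤ 1361 / (1 - beta t t') := by
    refine (two_pow_estimationQubits_le hε (additiveError_le_half ht'.le)).trans ?_
    rw [div_le_div_iff₀ hε hβ]
    linarith [one_sub_beta_le_additiveError ht' h ht]
  have hs : (3 : ℝ) ^ (0 + (lastIter t + 1)) ≤ 3 / √t := by
    have := pow_lastIter_le ht0 ht
    rw [zero_add, pow_succ, show 3 / √t = 1 / √t * 3 by ring]
    gcongr
  calc ((amplitudeSeparation ini out t t' δ).calls : ℝ) ≤ _ := hloop'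
    _ ≤ 9 * Real.log ((1 + lastIter t) / δ) * (1361 / (1 - beta t t')) * (3 / √t) := by gcongr
    _ = 36747 * (1 / ((1 - beta t t') * √t)) * Real.log ((1 + lastIter t) / δ) := by
      field_simp
      norm_num
    _ ≤ _ := by gcongr; norm_num

/-- With `a = 1/((1-β)√t)`, `1 + s ≤ a` because `1 + s ≤ 3^s ≤ 1/√t` up to Bernoulli. Since `δ ≤
1/2`, also `a ≤ 2g` for `g = a log (1/δ)`. Thus `log (1+s) ≤ 1 + log (1+g)`, and the two summands of
the logarithm contribute 2 and 1 to the constant 3. -/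
theorem mul_log_le_softBound {t t' δ : ℝ} (ht' : 0 < t') (h : t' < t) (ht : t ≤ 1) (hδ : 0 < δ)
    (hδ' : δ ≤ 1 / 2) :
    1 / ((1 - beta t t') * √t) * Real.log ((1 + lastIter t) / δ) ≤
      3 * softBound (1 / ((1 - beta t t') * √t) * Real.log (1 / δ)) := by
  have ht0 := ht'.trans h
  have hβ : 0 < 1 - beta t t' := sub_pos.mpr (beta_lt_one ht0 h)
  have hst : 0 < √t := Real.sqrt_pos.mpr ht0
  have hs1 : 1 + (lastIter t : ℝ) ≤ 1 / ((1 - beta t t') * √t) := by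
    refine (one_add_lastIter_le ht0 ht).trans ?_
    gcongr
    exact mul_le_of_le_one_left hst.le (by linarith [beta_nonneg t t'])
  have hs0 : 0 < 1 + (lastIter t : ℝ) := by positivity
  have hlog : 1 / 2 ≤ Real.log (1 / δ) := by
    refine (by linarith [Real.log_two_gt_d9] : 1 / 2 ≤ Real.log 2).trans
      (Real.log_le_log two_pos ?_)
    rw [le_div_iff₀ hδ]
    linarith
  rw [show (1 + (lastIter t : ℝ)) / δ = (1 + lastIter t) * (1 / δ) by ring,
    Real.log_mul hs0.ne' (by positivity), softBound]
  generalize 1 / ((1 - beta t t') * √t) = a at *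
  generalize Real.log (1 / δ) = L at *
  have ha : 0 < a := hs0.trans_le hs1
  have haL : a ≤ 2 * (a * L) := by nlinarith
  have hg : 0 < a * L := by linarith
  have hlog0 : 0 ≤ Real.log (1 + a * L) := Real.log_nonneg (by linarith)
  have hls : Real.log (1 + lastIter t) ≤ 1 + Real.log (1 + a * L) := by
    calc Real.log (1 + lastIter t) ≤ Real.log (2 * (1 + a * L)) :=
          Real.log_le_log hs0 (by linarith)
      _ = Real.log 2 + Real.log (1 + a * L) := Real.log_mul two_ne_zero (by linarith)
      _ ≤ _ := by linarith [Real.log_two_lt_d9]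
  have h1 : a * Real.log (1 + lastIter t) ≤ 2 * (a * L) * (1 + Real.log (1 + a * L)) :=
    (mul_le_mul_of_nonneg_left hls ha.le).trans
      (mul_le_mul_of_nonneg_right haL (by linarith))
  nlinarith [mul_nonneg hg.le hlog0]

end AmplitudeSeparation

open AmplitudeSeparation in
theorem mainTheorem1 :
    (∀ (n : ℕ) (A : Matrix.unitaryGroup (Bits n) ℂ) (ini : PureState n) (out : Fin n)
      (t t' δ : ℝ), 0 < t' → t' < t → t ≤ 1 → 0 < δ → δ < 1 →
      (t ≤ acceptanceProb A ini out →
        1 - δ ≤ (amplitudeSeparation ini out t t' δ).outputProb A ini true) ∧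
      (acceptanceProb A ini out ≤ t' →
        1 - δ ≤ (amplitudeSeparation ini out t t' δ).outputProb A ini false)) ∧
    (∃ C : ℝ, 0 < C ∧ ∀ (n : ℕ) (ini : PureState n) (out : Fin n) (t t' δ : ℝ),
      0 < t' → t' < t → t ≤ 1 → 0 < δ → δ ≤ 1 / 2 →
      ((amplitudeSeparation ini out t t' δ).calls : ℝ) ≤
          C * (1 / ((1 - beta t t') * Real.sqrt t)) * Real.log ((1 + lastIter t) / δ) ∧
      ((amplitudeSeparation ini out t t' δ).calls : ℝ) ≤
          C * softBound (1 / ((1 - beta t t') * Real.sqrt t) * Real.log (1 / δ)) ∧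
      ((amplitudeSeparation ini out t t' δ).calls : ℝ) ≤
          C * softBound (1 / (Real.sqrt t - Real.sqrt t') * Real.log (1 / δ))) := by
  refine ⟨fun n A ini out t t' δ ht' h ht hδ hδ1 =>
    ⟨amplitudeSeparation_accepts A ini out ht' h ht hδ,
      amplitudeSeparation_rejects A ini out ht' h ht hδ hδ1⟩,
    -- This is `40000 · 3`, the product of the constants of the two preceding bounds.
    120000, by norm_num, fun n ini out t t' δ ht' h ht hδ hδ' => ?_⟩
  have ht0 := ht'.trans h
  have hβ : 0 < 1 - beta t t' := sub_pos.mpr (beta_lt_one ht0 h)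
  have hst : 0 < √t := Real.sqrt_pos.mpr ht0
  have hlog : 0 ≤ Real.log ((1 + lastIter t) / δ) := by
    refine Real.log_nonneg ?_
    rw [one_le_div hδ]
    linarith [Nat.cast_nonneg (α := ℝ) (lastIter t)]
  have hsub : √t - √t' = (1 - beta t t') * √t := by
    rw [sub_mul, one_mul, beta_mul_sqrt ht'.le ht0]
  have h1 := calls_amplitudeSeparation_le ini out ht' h ht hδ hδ'
  have h2 := mul_log_le_softBound ht' h ht hδ hδ'
  rw [mul_assoc] at h1
  have h3 : ((amplitudeSeparation ini out t t' δ).calls : ℝ) ≤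
      120000 * softBound (1 / ((1 - beta t t') * √t) * Real.log (1 / δ)) := by linarith
  refine ⟨?_, h3, by rwa [hsub]⟩
  have h4 : 0 ≤ 1 / ((1 - beta t t') * √t) * Real.log ((1 + lastIter t) / δ) := by positivity
  rw [mul_assoc]
  linarith
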